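/- **Theorem 1.3 (Spectral theory in $d=1$).** On $L^2(\mathbb R)$ let $\mathcal F$ be the unitary Fourier transform $(\mathcal F\psi)(k)=(2\pi)^{-1/2}\int_{\mathbb R}e^{-ikx}\psi(x)\,dx$, and for $\lambda>0$ let $(S_\lambda\psi)(x)=\psi(x-\tfrac1\lambda)$. Let $\Pi$ be the closure, with domain $D_0$, of the symmetric operator $\psi\mapsto i(x\psi+x^2\psi')$ defined on the Schwartz space $\mathcal S(\mathbb R)$. For an angle $\theta$ put $\zeta_\theta(x)=\frac1x e^{-1/|x|}e^{i\,\mathrm{sgn}(x)\theta/2}$, and let $\Pi_0$ be the operator with domain $D(\Pi_0)=\{\psi+c\,\zeta_0 : \psi\in D_0,\ c\in\mathbb C\}$ and action $\Pi_0(\psi+c\,\zeta_0)=\Pi\psi+c\,\zeta_\pi$. A *one-dimensional thermal Hamiltonian* with coupling constant $\lambda>0$ is an operator $\lambda(\mathcal F S_\lambda)^*P(\mathcal F S_\lambda)$ with domain $(\mathcal F S_\lambda)^*[D(P)]$, where $P$ is a self-adjoint extension of $\Pi$. For every $\lambda>0$ the operator $$H_T=H_T(\lambda):=\lambda(\mathcal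 F S_\lambda)^*\,\Pi_0\,(\mathcal F S_\lambda)$$ is a one-dimensional thermal Hamiltonian with coupling constant $\lambda$, and every one-dimensional thermal Hamiltonian with coupling constant $\lambda$ is unitarily equivalent to $H_T$. The operator $H_T$ is self-adjoint on its domain $D(H_T)=(\mathcal F S_\lambda)^*[D(\Pi_0)]$. Its spectrum is purely absolutely continuous (for every $\psi\in L^2(\mathbb R)$ the spectral measure of $\psi$ with respect to $H_T$ is absolutely continuous with respect to Lebesgue measure), and $$\sigma(H_T)=\sigma_{\mathrm{a.c.}}(H_T)=\mathbb R,$$ independently of $\lambda>0$. Here $\sigma_{\mathrm{a.c.}}(H_T)$ is the spectrum of the part of $H_T$ in the closed subspace of all vectors with absolutely continuous spectral measure. -/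

import Mathlib

open MeasureTheory
open scoped ENNReal SchwartzMap

namespace Thermal

/-! ### Unbounded operators on a Hilbert space -/

section Operators

variable {H : Type*} [NormedAddCommGroup H] [InnerProductSpace ℂ H]

/-- The resolvent set of an unbounded operator `A`: those `z` for which `A - z` is a bijection of
the domain of `A` onto `H` with a bounded everywhere defined inverse `R`. -/
def resolventSet (A : H →ₗ.[ℂ] H) : Set ℂ :=
  {z | ∃ R : H →L[ℂ] H,
    (∀ y : H, ∃ h : R y ∈ A.domain, A ⟨R y, h⟩ - z • R y = y) ∧
    (∀ x : A.domain, R (A x - z • (x : H)) = x)}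

/-- The spectrum of an unbounded operator. -/
def opSpectrum (A : H →ₗ.[ℂ] H) : Set ℂ := (resolventSet A)ᶜ

/-- The conjugate `U* A U` of an unbounded operator by a unitary `U`; its domain is
`U*[D(A)] = {ψ | U ψ ∈ D(A)}`. -/
noncomputable def conjBy (U : H ≃ₗᵢ[ℂ] H) (A : H →ₗ.[ℂ] H) : H →ₗ.[ℂ] H where
  domain := A.domain.comap (U.toLinearEquiv : H →ₗ[ℂ] H)
  toFun :=
    { toFun := fun x => U.symm (A ⟨U x, x.2⟩)
      map_add' := fun x y => by
        rw [← map_add, ← LinearPMap.map_add]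
        congr 2
        exact Subtype.ext (map_add U (x : H) (y : H))
      map_smul' := fun c x => by
        rw [RingHom.id_apply, ← map_smul, ← LinearPMap.map_smul]
        congr 2
        exact Subtype.ext (map_smul U c (x : H)) }

/-- Two unbounded operators are unitarily equivalent. -/
def UnitarilyEquivalent (A B : H →ₗ.[ℂ] H) : Prop :=
  ∃ U : H ≃ₗᵢ[ℂ] H, A = conjBy U B

/-- The part of `A` in a subspace `K`: the operator on `K` with domain
`{x ∈ D(A) ∩ K | A x ∈ K}` acting as `A`. -/
noncomputable def partOn (A : H →ₗ.[ℂ] H) (K : Submodule ℂ H) : K →ₗ.[ℂ] K where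
  domain :=
    { carrier := {x | ∃ h : (x : H) ∈ A.domain, A ⟨x, h⟩ ∈ K}
      zero_mem' := ⟨A.domain.zero_mem, by
        have : A ⟨((0 : K) : H), A.domain.zero_mem⟩ = 0 := LinearPMap.map_zero A
        rw [this]
        exact K.zero_mem⟩
      add_mem' := by
        rintro x y ⟨hx, hx'⟩ ⟨hy, hy'⟩
        refine ⟨A.domain.add_mem hx hy, ?_⟩
        have := A.map_add ⟨x, hx⟩ ⟨y, hy⟩
        exact this ▸ K.add_mem hx' hy'
      smul_mem' := by
        rintro c x ⟨hx, hx'⟩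
        refine ⟨A.domain.smul_mem c hx, ?_⟩
        have := A.map_smul c ⟨x, hx⟩
        exact this ▸ K.smul_mem c hx' }
  toFun :=
    { toFun := fun x => ⟨A ⟨x, x.2.choose⟩, x.2.choose_spec⟩
      map_add' := fun x y => Subtype.ext (A.map_add ⟨x, x.2.choose⟩ ⟨y, y.2.choose⟩)
      map_smul' := fun c x => Subtype.ext (A.map_smul c ⟨x, x.2.choose⟩) }

end Operators

/-! ### Projection-valued measures and absolutely continuous spectrum -/

/-- A projection-valued measure on (the Borel sets of) `ℝ`; countable additivity is with respect to
the strong operator topology. -/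
structure ProjectionValuedMeasure (H : Type*) [NormedAddCommGroup H] [InnerProductSpace ℂ H]
    [CompleteSpace H] where
  proj : Set ℝ → H →L[ℂ] H
  isStarProjection : ∀ B, MeasurableSet B → IsStarProjection (proj B)
  proj_empty : proj ∅ = 0
  proj_univ : proj Set.univ = 1
  proj_inter : ∀ B C, MeasurableSet B → MeasurableSet C → proj (B ∩ C) = proj B * proj C
  hasSum_proj : ∀ B : ℕ → Set ℝ, (∀ n, MeasurableSet (B n)) →
    Pairwise (Function.onFun Disjoint B) →
    ∀ ψ : H, HasSum (fun n => proj (B n) ψ) (proj (⋃ n, B n) ψ)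

namespace ProjectionValuedMeasure

variable {H : Type*} [NormedAddCommGroup H] [InnerProductSpace ℂ H] [CompleteSpace H]

theorem inner_proj (E : ProjectionValuedMeasure H) {B : Set ℝ} (hB : MeasurableSet B) (ψ : H) :
    (inner ℂ ψ (E.proj B ψ)).re = ‖E.proj B ψ‖ ^ 2 := by
  have h := E.isStarProjection B hB
  have h1 : E.proj B (E.proj B ψ) = E.proj B ψ := by
    have := congrArg (fun T : H →L[ℂ] H => T ψ) h.isIdempotentElem.eq
    simpa using this
  have h2 : inner ℂ (E.proj B ψ) (E.proj B ψ) = inner ℂ ψ (E.proj B ψ) := by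
    have h3 : ContinuousLinearMap.adjoint (E.proj B) = E.proj B := h.isSelfAdjoint
    conv_lhs => rw [← ContinuousLinearMap.adjoint_inner_right, h3, h1]
  rw [← h2, inner_self_eq_norm_sq_to_K]
  norm_cast

/-- The spectral measure `μ_ψ(B) = ⟨ψ, E(B) ψ⟩` of the vector `ψ`. -/
noncomputable def scalarMeasure (E : ProjectionValuedMeasure H) (ψ : H) : Measure ℝ :=
  Measure.ofMeasurable (fun B _ => ENNReal.ofReal (inner ℂ ψ (E.proj B ψ)).re)
    (by simp [E.proj_empty])
    (by
      intro B hB hd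
      have hs : HasSum (fun n => (inner ℂ ψ (E.proj (B n) ψ)).re)
          (inner ℂ ψ (E.proj (⋃ n, B n) ψ)).re :=
        Complex.hasSum_re ((innerSL ℂ ψ).hasSum (E.hasSum_proj B hB hd ψ))
      rw [← hs.tsum_eq]
      refine ENNReal.ofReal_tsum_of_nonneg (fun n => ?_) hs.summable
      rw [E.inner_proj (hB n)]
      positivity)

theorem scalarMeasure_apply (E : ProjectionValuedMeasure H) (ψ : H) {B : Set ℝ}
    (hB : MeasurableSet B) :
    E.scalarMeasure ψ B = ENNReal.ofReal (inner ℂ ψ (E.proj B ψ)).re :=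
  Measure.ofMeasurable_apply B hB

theorem scalarMeasure_eq_zero_iff (E : ProjectionValuedMeasure H) (ψ : H) {B : Set ℝ}
    (hB : MeasurableSet B) : E.scalarMeasure ψ B = 0 ↔ E.proj B ψ = 0 := by
  rw [E.scalarMeasure_apply ψ hB, E.inner_proj hB, ENNReal.ofReal_eq_zero]
  constructor
  · intro h
    have : ‖E.proj B ψ‖ ^ 2 = 0 := le_antisymm h (by positivity)
    simpa using this
  · intro h
    simp [h]

/-- `E` is the spectral resolution of the operator `A`, i.e. `A = ∫ x dE(x)`: the domain of `A`
consists of the `ψ` with `∫ x² dμ_ψ(x) < ∞`, and `⟨ψ, A ψ⟩ = ∫ x dμ_ψ(x)` for these `ψ`.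
By the spectral theorem every self-adjoint operator has exactly one spectral resolution. -/
def IsResolutionOf (E : ProjectionValuedMeasure H) (A : H →ₗ.[ℂ] H) : Prop :=
  (∀ ψ : H, ψ ∈ A.domain ↔ ∫⁻ x, ENNReal.ofReal (x ^ 2) ∂(E.scalarMeasure ψ) < ∞) ∧
  (∀ ψ : A.domain, inner ℂ (ψ : H) (A ψ) = ((∫ x, x ∂(E.scalarMeasure (ψ : H)) : ℝ) : ℂ))

/-- The absolutely continuous subspace: all `ψ` whose spectral measure is absolutely continuous
with respect to Lebesgue measure. -/
def acSubspace (E : ProjectionValuedMeasure H) : Submodule ℂ H where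
  carrier := {ψ | E.scalarMeasure ψ ≪ volume}
  zero_mem' := Measure.AbsolutelyContinuous.mk fun B hB _ => by
    rw [E.scalarMeasure_eq_zero_iff _ hB, map_zero]
  add_mem' := fun {φ ψ} hφ hψ => Measure.AbsolutelyContinuous.mk fun B hB h0 => by
    rw [E.scalarMeasure_eq_zero_iff _ hB, map_add,
      (E.scalarMeasure_eq_zero_iff _ hB).1 (hφ h0), (E.scalarMeasure_eq_zero_iff _ hB).1 (hψ h0),
      add_zero]
  smul_mem' := fun c ψ hψ => Measure.AbsolutelyContinuous.mk fun B hB h0 => by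
    rw [E.scalarMeasure_eq_zero_iff _ hB, map_smul,
      (E.scalarMeasure_eq_zero_iff _ hB).1 (hψ h0), smul_zero]

/-- The absolutely continuous spectrum of an operator `A` with spectral resolution `E`: the
spectrum of the part of `A` in the absolutely continuous subspace. -/
def acSpectrum (E : ProjectionValuedMeasure H) (A : H →ₗ.[ℂ] H) : Set ℂ :=
  opSpectrum (partOn A E.acSubspace)

end ProjectionValuedMeasure

/-! ### The unitaries on `L²(ℝ)` -/

/-- The Hilbert space `L²(ℝ)` of complex-valued functions. -/
abbrev L2R : Type := Lp ℂ 2 (volume : Measure ℝ)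

theorem map_affine (a b : ℝ) (ha : a ≠ 0) :
    Measure.map (fun x : ℝ => a * x + b) volume = ENNReal.ofReal |a⁻¹| • volume := by
  have h : (fun x : ℝ => a * x + b) = (fun y => y + b) ∘ (fun x => a * x) := rfl
  rw [h, ← Measure.map_map (by fun_prop) (by fun_prop), Real.map_volume_mul_left ha,
    Measure.map_smul, map_add_right_eq_self]

theorem quasi_affine (a b : ℝ) (ha : a ≠ 0) :
    Measure.QuasiMeasurePreserving (fun x : ℝ => a * x + b) volume volume :=
  ⟨by fun_prop, by
    rw [map_affine a b ha]
    exact Measure.smul_absolutelyContinuous⟩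

theorem eLpNorm_affine (a b : ℝ) (ha : a ≠ 0) (f : L2R) :
    eLpNorm (fun x : ℝ => (√|a| : ℂ) * f (a * x + b)) 2 volume = eLpNorm f 2 volume := by
  have h0 : |a| ≠ 0 := abs_ne_zero.2 ha
  have hpos : 0 < |a| := abs_pos.2 ha
  have h1 : eLpNorm (fun x : ℝ => f (a * x + b)) 2 volume
      = eLpNorm f 2 (Measure.map (fun x : ℝ => a * x + b) volume) := by
    rw [eLpNorm_map_measure]
    · rfl
    · rw [map_affine a b ha]
      exact (Lp.aestronglyMeasurable f).smul_measure _
    · fun_prop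
  have h2 : (fun x : ℝ => (√|a| : ℂ) * f (a * x + b))
      = (√|a| : ℂ) • (fun x : ℝ => f (a * x + b)) := by
    ext x; simp
  rw [h2, eLpNorm_const_smul, h1, map_affine a b ha,
    eLpNorm_smul_measure_of_ne_top (by norm_num), smul_eq_mul, ← mul_assoc]
  have h3 : ‖(√|a| : ℂ)‖ₑ * ENNReal.ofReal |a⁻¹| ^ (1 / (2 : ℝ≥0∞)).toReal = 1 := by
    have e1 : ‖(√|a| : ℂ)‖ₑ = ENNReal.ofReal (√|a|) := by
      rw [← ofReal_norm]
      simp [abs_of_nonneg (Real.sqrt_nonneg _)]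
    have e2 : (1 / (2 : ℝ≥0∞)).toReal = 1 / 2 := by simp
    rw [e1, e2, ENNReal.ofReal_rpow_of_nonneg (abs_nonneg _) (by norm_num),
      ← ENNReal.ofReal_mul (Real.sqrt_nonneg _), ← Real.sqrt_eq_rpow, ← Real.sqrt_mul hpos.le,
      abs_inv, mul_inv_cancel₀ h0]
    simp
  rw [h3, one_mul]

theorem memLp_affine (a b : ℝ) (ha : a ≠ 0) (f : L2R) :
    MemLp (fun x : ℝ => (√|a| : ℂ) * f (a * x + b)) 2 volume := by
  refine ⟨?_, ?_⟩
  · exact ((Lp.aestronglyMeasurable f).comp_quasiMeasurePreserving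
      (quasi_affine a b ha)).const_mul _
  · rw [eLpNorm_affine a b ha]
    exact (Lp.memLp f).2

/-- The isometry `(U ψ)(x) = |a|^{1/2} ψ(a x + b)` of `L²(ℝ)`. -/
noncomputable def affineIsometry (a b : ℝ) (ha : a ≠ 0) : L2R →ₗᵢ[ℂ] L2R where
  toFun f := (memLp_affine a b ha f).toLp _
  map_add' f g := by
    rw [← MemLp.toLp_add, MemLp.toLp_eq_toLp_iff]
    filter_upwards [(quasi_affine a b ha).ae (Lp.coeFn_add f g)] with x hx
    simp only [Pi.add_apply] at hx ⊢
    rw [hx, mul_add]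
  map_smul' c f := by
    rw [RingHom.id_apply, ← MemLp.toLp_const_smul, MemLp.toLp_eq_toLp_iff]
    filter_upwards [(quasi_affine a b ha).ae (Lp.coeFn_smul c f)] with x hx
    simp only [Pi.smul_apply, smul_eq_mul] at hx ⊢
    rw [hx]
    ring
  norm_map' f := by
    change ‖(memLp_affine a b ha f).toLp _‖ = ‖f‖
    rw [Lp.norm_toLp, eLpNorm_affine a b ha, Lp.norm_def]

theorem affineIsometry_coeFn (a b : ℝ) (ha : a ≠ 0) (f : L2R) :
    affineIsometry a b ha f =ᵐ[volume] fun x => (√|a| : ℂ) * f (a * x + b) :=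
  (memLp_affine a b ha f).coeFn_toLp

theorem affineIsometry_comp (a b : ℝ) (ha : a ≠ 0) (f : L2R) :
    affineIsometry a b ha (affineIsometry a⁻¹ (-(a⁻¹ * b)) (inv_ne_zero ha) f) = f := by
  apply Lp.ext
  filter_upwards [affineIsometry_coeFn a b ha (affineIsometry a⁻¹ (-(a⁻¹ * b)) (inv_ne_zero ha) f),
    (quasi_affine a b ha).ae (affineIsometry_coeFn a⁻¹ (-(a⁻¹ * b)) (inv_ne_zero ha) f)] with x h1 h2
  have h0 : |a| ≠ 0 := abs_ne_zero.2 ha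
  have e : a⁻¹ * (a * x + b) + -(a⁻¹ * b) = x := by
    field_simp
    ring
  have h3 : (√|a| : ℂ) * (√|a⁻¹| : ℂ) = 1 := by
    rw [← Complex.ofReal_mul, ← Real.sqrt_mul (abs_nonneg _), abs_inv, mul_inv_cancel₀ h0]
    simp
  rw [h1, h2, e, ← mul_assoc, h3, one_mul]

/-- The unitary `(U ψ)(x) = |a|^{1/2} ψ(a x + b)` of `L²(ℝ)`. -/
noncomputable def affineUnitary (a b : ℝ) (ha : a ≠ 0) : L2R ≃ₗᵢ[ℂ] L2R :=
  LinearIsometryEquiv.ofSurjective (affineIsometry a b ha)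
    fun f => ⟨_, affineIsometry_comp a b ha f⟩

/-- The translation `(S_λ ψ)(x) = ψ(x - 1/λ)`. -/
noncomputable def translation (lam : ℝ) : L2R ≃ₗᵢ[ℂ] L2R :=
  affineUnitary 1 (-(1 / lam)) one_ne_zero

theorem translation_coeFn (lam : ℝ) (f : L2R) :
    translation lam f =ᵐ[volume] fun x => f (x - 1 / lam) := by
  refine (affineIsometry_coeFn 1 (-(1 / lam)) one_ne_zero f).trans (Filter.Eventually.of_forall ?_)
  intro x
  simp [sub_eq_add_neg]

/-- The unitary Fourier transform `(F ψ)(k) = (2π)^{-1/2} ∫ exp(-i k x) ψ(x) dx` on `L²(ℝ)`,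
obtained from Mathlib's `(𝓕 ψ)(ξ) = ∫ exp(-2π i ξ x) ψ(x) dx` by the dilation
`(F ψ)(k) = (2π)^{-1/2} (𝓕 ψ)(k / (2π))`. -/
noncomputable def fourierUnitary : L2R ≃ₗᵢ[ℂ] L2R :=
  (Lp.fourierTransformₗᵢ ℝ ℂ).trans
    (affineUnitary (2 * Real.pi)⁻¹ 0 (inv_ne_zero (by positivity)))

theorem fourierUnitary_coeFn (ψ : 𝓢(ℝ, ℂ)) :
    fourierUnitary (ψ.toLp 2) =ᵐ[volume] fun k =>
      (√(2 * Real.pi) : ℂ)⁻¹ * ∫ x : ℝ, Complex.exp (-(Complex.I * k * x)) * ψ x := by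
  have ha : (2 * Real.pi)⁻¹ ≠ 0 := inv_ne_zero (by positivity)
  have h1 : Lp.fourierTransformₗᵢ ℝ ℂ (ψ.toLp 2) = (FourierTransform.fourier ψ).toLp 2 :=
    SchwartzMap.toLp_fourier_eq ψ
  have h2 : fourierUnitary (ψ.toLp 2)
      = affineIsometry (2 * Real.pi)⁻¹ 0 ha ((FourierTransform.fourier ψ).toLp 2) := by
    rw [← h1]
    rfl
  rw [h2]
  filter_upwards [affineIsometry_coeFn (2 * Real.pi)⁻¹ 0 ha ((FourierTransform.fourier ψ).toLp 2),
    (quasi_affine (2 * Real.pi)⁻¹ 0 ha).ae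
      ((FourierTransform.fourier ψ).coeFn_toLp 2 volume)] with k hk hk'
  rw [hk, hk', SchwartzMap.fourier_coe, Real.fourier_real_eq_integral_exp_smul]
  have hp : |(2 * Real.pi)⁻¹| = (2 * Real.pi)⁻¹ := abs_of_pos (by positivity)
  rw [hp, Real.sqrt_inv, Complex.ofReal_inv]
  congr 2
  ext x
  rw [smul_eq_mul]
  congr 2
  have : (Real.pi : ℂ) ≠ 0 := by exact_mod_cast Real.pi_ne_zero
  push_cast
  field_simp
  ring

/-- The unitary `F S_λ`. -/
noncomputable def fourierTranslation (lam : ℝ) : L2R ≃ₗᵢ[ℂ] L2R :=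
  (translation lam).trans fourierUnitary

/-! ### The operator `Π` and its self-adjoint realizations -/

/-- The differential expression `Π ψ = i (x ψ + x² ψ')` on Schwartz functions. -/
noncomputable def piSchwartz : 𝓢(ℝ, ℂ) →ₗ[ℂ] 𝓢(ℝ, ℂ) :=
  Complex.I • ((SchwartzMap.smulLeftCLM ℂ (fun x : ℝ => (x : ℂ))).toLinearMap +
    (SchwartzMap.smulLeftCLM ℂ (fun x : ℝ => (x : ℂ) ^ 2)).toLinearMap ∘ₗ
      (SchwartzMap.derivCLM ℂ ℂ).toLinearMap)

theorem piSchwartz_apply (ψ : 𝓢(ℝ, ℂ)) (x : ℝ) :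
    piSchwartz ψ x = Complex.I * ((x : ℂ) * ψ x + (x : ℂ) ^ 2 * deriv ψ x) := by
  have h1 : Function.HasTemperateGrowth (fun x : ℝ => (x : ℂ)) :=
    Complex.ofRealCLM.hasTemperateGrowth
  have h2 : Function.HasTemperateGrowth (fun x : ℝ => (x : ℂ) ^ 2) := by
    simp only [pow_two]
    exact h1.mul h1
  simp [piSchwartz, SchwartzMap.smulLeftCLM_apply_apply h1, SchwartzMap.smulLeftCLM_apply_apply h2,
    mul_add]

/-- The embedding of the Schwartz space into `L²(ℝ)`, as a linear isomorphism onto its range. -/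
noncomputable def schwartzEquiv :
    𝓢(ℝ, ℂ) ≃ₗ[ℂ] LinearMap.range (SchwartzMap.toLpCLM ℂ ℂ 2 (volume : Measure ℝ)).toLinearMap :=
  LinearEquiv.ofInjective (SchwartzMap.toLpCLM ℂ ℂ 2 (volume : Measure ℝ)).toLinearMap
    (SchwartzMap.injective_toLp 2 volume)

/-- The operator `Π` on the Schwartz space, as a densely defined operator on `L²(ℝ)`. -/
noncomputable def piMin : L2R →ₗ.[ℂ] L2R where
  domain := LinearMap.range (SchwartzMap.toLpCLM ℂ ℂ 2 (volume : Measure ℝ)).toLinearMap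
  toFun := (SchwartzMap.toLpCLM ℂ ℂ 2 (volume : Measure ℝ)).toLinearMap ∘ₗ piSchwartz ∘ₗ
    schwartzEquiv.symm.toLinearMap

/-- The closed symmetric operator `Π`, with domain `D₀` the closure of the Schwartz space in the
graph norm. -/
noncomputable def piClosed : L2R →ₗ.[ℂ] L2R := piMin.closure

/-- The function `ζ_θ(x) = x⁻¹ exp(-1/|x|) exp(i sgn(x) θ/2)`. -/
noncomputable def zetaFun (θ : ℝ) (x : ℝ) : ℂ :=
  (x⁻¹ * Real.exp (-(1 / |x|)) : ℝ) * Complex.exp (Complex.I * (SignType.sign x : ℝ) * (θ / 2))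

theorem memLp_zetaFun (θ : ℝ) : MemLp (zetaFun θ) 2 (volume : Measure ℝ) := by
  have hmeas : Measurable (zetaFun θ) := by
    have hs : Measurable (fun x : ℝ => ((SignType.sign x : ℝ) : ℂ)) := by
      have : (fun x : ℝ => ((SignType.sign x : ℝ) : ℂ))
          = fun x : ℝ => if 0 < x then (1 : ℂ) else if x < 0 then -1 else 0 := by
        ext x
        rcases lt_trichotomy x 0 with h | h | h
        · simp [sign_neg h, h, not_lt.2 h.le]
        · simp [h]
        · simp [sign_pos h, h]
      rw [this]
      exact Measurable.ite measurableSet_Ioi measurable_const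
        (Measurable.ite measurableSet_Iio measurable_const measurable_const)
    unfold zetaFun
    fun_prop
  rw [memLp_two_iff_integrable_sq_norm hmeas.aestronglyMeasurable]
  refine (integrable_inv_one_add_sq).mono' (hmeas.norm.pow_const 2).aestronglyMeasurable
    (Filter.Eventually.of_forall fun x => ?_)
  have hn : ‖zetaFun θ x‖ = |x⁻¹| * Real.exp (-(1 / |x|)) := by
    have : Complex.I * (SignType.sign x : ℝ) * (θ / 2)
        = (((SignType.sign x : ℝ) * (θ / 2) : ℝ) : ℂ) * Complex.I := by
      push_cast
      ring
    rw [zetaFun, norm_mul, this, Complex.norm_exp_ofReal_mul_I, mul_one, Complex.norm_real,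
      Real.norm_eq_abs, abs_mul, abs_of_pos (Real.exp_pos _)]
  rw [hn, Real.norm_eq_abs, abs_of_nonneg (by positivity)]
  rcases eq_or_ne x 0 with rfl | hx
  · simp
  have hpos : 0 < |x|⁻¹ := inv_pos.2 (abs_pos.2 hx)
  rw [abs_inv, one_div, ← sq_abs x]
  set t := |x|⁻¹ with ht
  have hxt : |x| = t⁻¹ := by rw [ht, inv_inv]
  rw [hxt, mul_pow, ← Real.exp_nat_mul]
  have hexp : 1 + t ^ 2 ≤ Real.exp (2 * t) := by
    have := Real.quadratic_le_exp_of_nonneg (x := 2 * t) (by positivity)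
    nlinarith
  have h4 : Real.exp ((2 : ℕ) * -t) = (Real.exp (2 * t))⁻¹ := by
    rw [← Real.exp_neg]
    congr 1
    push_cast
    ring
  have h5 : (1 + t⁻¹ ^ 2)⁻¹ = t ^ 2 * (1 + t ^ 2)⁻¹ := by
    field_simp
    ring
  rw [h4, h5]
  gcongr

/-- `ζ_θ` as an element of `L²(ℝ)`. -/
noncomputable def zeta (θ : ℝ) : L2R := (memLp_zetaFun θ).toLp _

/-- The realization `Π_θ`, with domain `{ψ + c ζ_θ | ψ ∈ D₀, c ∈ ℂ}` and
`Π_θ (ψ + c ζ_θ) = Π ψ + c ζ_{θ+π}`, given by its graph. -/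
noncomputable def piTheta (θ : ℝ) : L2R →ₗ.[ℂ] L2R :=
  (piClosed.graph ⊔ Submodule.span ℂ {(zeta θ, zeta (θ + Real.pi))}).toLinearPMap

/-- `A` is a one-dimensional thermal Hamiltonian with coupling constant `λ`: it is
`λ (F S_λ)* P (F S_λ)` for some self-adjoint extension `P` of the closed symmetric operator `Π`. -/
def IsThermalHamiltonian (lam : ℝ) (A : L2R →ₗ.[ℂ] L2R) : Prop :=
  ∃ P : L2R →ₗ.[ℂ] L2R, IsSelfAdjoint P ∧ piClosed ≤ P ∧
    A = (lam : ℂ) • conjBy (fourierTranslation lam) P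

/-- The standard realization `H_T = λ (F S_λ)* Π₀ (F S_λ)`. -/
noncomputable def thermalHamiltonian (lam : ℝ) : L2R →ₗ.[ℂ] L2R :=
  (lam : ℂ) • conjBy (fourierTranslation lam) (piTheta 0)

end Thermal

open Thermal

/-!
Put `u = 1 / x` and `(I ψ)(u) = u⁻¹ ψ(u⁻¹)`. The involution `I` is unitary on `L²(ℝ)` and turns the
expression `i (x ψ + x² ψ')` into `-i d/du`. A Schwartz function `ψ` becomes a function that
vanishes at `u = 0`, while `ζ_θ` becomes `e^{-|u|} e^{i sgn(u) θ/2}`, which may jump there. So `Π` is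
`-i d/du` with the condition `φ(0) = 0`, its self-adjoint extensions prescribe a phase jump at
`u = 0`, and `Π₀` is the extension without jump, that is, `-i d/du` on the whole line. The Fourier
transform diagonalizes the latter: `piDiag` is the conjugate of multiplication by `2πx` by
`diagUnitary`, and `piTheta_zero` says that it equals `Π₀`.

To identify the operators, graphs are compared through the maps `(f, g) ↦ g ± if`. Integration by
parts (`stepCLM_schwartz_mem_graph`, `zeta_mem_graph`) shows that the Schwartz space and `ζ₀` lie in
the domain of `piDiag`. In the other direction, the range of `Π ± i` is closed, and a vector `η`
orthogonal to it solves a first-order differential equation in the weak sense on each half-line.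
By the du Bois-Reymond lemma (`ae_eq_const_of_integral_deriv_smul_eq_zero`), `η` is a multiple of
`x⁻¹ e^{∓1/x}` there, and this is square integrable on one half-line only. Hence both deficiency
spaces are spanned by one vector, the restriction of `ζ₀` to a half-line (`exists_eq_smul_defect`),
and adding `ζ₀` to the domain of `Π` fills up `piDiag`.

For an arbitrary self-adjoint extension `P` the Cayley transform maps one deficiency vector to a
unimodular multiple of the other. Multiplication by a unimodular step function, which leaves the
domain of `Π` invariant, absorbs this phase and conjugates `P` to `Π₀`
(`exists_conjBy_eq_piDiag`).

Consequently `H_T` is unitarily equivalent to multiplication by `2πλx`, for which the spectrum and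
the spectral resolution `B ↦ U* 1_{m ∈ B} U` are explicit (`opSpectrum_mulOp`,
`isResolutionOf_mulPVM`, `acSubspace_mulPVM`).
-/

namespace Thermal

/-! ### Symmetric graphs and self-adjointness -/

section AbstractOperators

variable {H : Type*} [NormedAddCommGroup H] [InnerProductSpace ℂ H]

/-- A linear relation `G` on a Hilbert space is symmetric if `⟨f', g⟩ = ⟨f, g'⟩` for all
`(f, f')` and `(g, g')` in `G`. -/
def SymmGraph (G : Submodule ℂ (H × H)) : Prop :=
  ∀ p ∈ G, ∀ q ∈ G, inner ℂ p.2 q.1 = inner ℂ p.1 q.2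

/-- The map `(f, g) ↦ g + iσf`; on the graph of an operator `A` its range is that of `A + iσ`. -/
noncomputable def shiftMap (H : Type*) [NormedAddCommGroup H] [InnerProductSpace ℂ H] (σ : ℝ) :
    H × H →L[ℂ] H :=
  ContinuousLinearMap.snd ℂ H H + ((σ : ℂ) * Complex.I) • ContinuousLinearMap.fst ℂ H H

@[simp]
theorem shiftMap_apply (σ : ℝ) (p : H × H) :
    shiftMap H σ p = p.2 + ((σ : ℂ) * Complex.I) • p.1 := rfl

theorem SymmGraph.mono {G G' : Submodule ℂ (H × H)} (hG' : SymmGraph G') (h : G ≤ G') :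
    SymmGraph G := fun p hp q hq => hG' p (h hp) q (h hq)

theorem SymmGraph.norm_sq_shiftMap {G : Submodule ℂ (H × H)} (hG : SymmGraph G) {σ : ℝ}
    (hσ : σ ^ 2 = 1) {p : H × H} (hp : p ∈ G) :
    ‖shiftMap H σ p‖ ^ 2 = ‖p.2‖ ^ 2 + ‖p.1‖ ^ 2 := by
  have h1 : (inner ℂ p.2 p.1).im = 0 := by
    have h := congrArg Complex.im (hG p hp p hp)
    rw [← inner_conj_symm p.1 p.2, Complex.conj_im] at h
    linarith
  have h2 : RCLike.re (inner ℂ p.2 (((σ : ℂ) * Complex.I) • p.1)) = 0 := by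
    rw [inner_smul_right]
    simp [h1]
  rw [shiftMap_apply, @norm_add_sq ℂ, h2, norm_smul]
  have h3 : ‖(σ : ℂ) * Complex.I‖ ^ 2 = 1 := by
    rw [norm_mul, Complex.norm_I, mul_one, Complex.norm_real, Real.norm_eq_abs, sq_abs, hσ]
  rw [mul_pow, h3]
  ring

theorem SymmGraph.eq_of_shiftMap_eq {G : Submodule ℂ (H × H)} (hG : SymmGraph G) {σ : ℝ}
    (hσ : σ ^ 2 = 1) {p q : H × H} (hp : p ∈ G) (hq : q ∈ G)
    (h : shiftMap H σ p = shiftMap H σ q) : p = q := by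
  have h1 := hG.norm_sq_shiftMap hσ (G.sub_mem hp hq)
  rw [map_sub, h, sub_self, norm_zero] at h1
  have h2 : ‖(p - q).2‖ = 0 := by nlinarith [sq_nonneg ‖(p - q).2‖, sq_nonneg ‖(p - q).1‖]
  have h3 : ‖(p - q).1‖ = 0 := by nlinarith [sq_nonneg ‖(p - q).2‖, sq_nonneg ‖(p - q).1‖]
  exact sub_eq_zero.1 (Prod.ext (norm_eq_zero.1 h3) (norm_eq_zero.1 h2))

/-- For a closed symmetric operator `A` the range of `A ± i` is closed. -/
theorem SymmGraph.isClosed_map_shiftMap [CompleteSpace H] {G : Submodule ℂ (H × H)}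
    (hG : SymmGraph G) (hc : IsClosed (G : Set (H × H))) {σ : ℝ} (hσ : σ ^ 2 = 1) :
    IsClosed ((G.map (shiftMap H σ).toLinearMap : Submodule ℂ H) : Set H) := by
  have : CompleteSpace G := hc.completeSpace_coe
  have hanti : AntilipschitzWith 1 ((shiftMap H σ).comp G.subtypeL) := by
    refine AddMonoidHomClass.antilipschitz_of_bound _ fun p => ?_
    have h := hG.norm_sq_shiftMap hσ p.2
    rw [NNReal.coe_one, one_mul]
    change max ‖(p : H × H).1‖ ‖(p : H × H).2‖ ≤ ‖shiftMap H σ p‖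
    refine max_le ?_ ?_ <;> refine le_of_sq_le_sq ?_ (norm_nonneg _) <;> rw [h]
    · nlinarith [sq_nonneg ‖(p : H × H).2‖]
    · nlinarith [sq_nonneg ‖(p : H × H).1‖]
  have h := hanti.isClosed_range ((shiftMap H σ).comp G.subtypeL).uniformContinuous
  convert h using 1
  ext y
  simp

theorem mem_graph_adjoint [CompleteSpace H] {A : H →ₗ.[ℂ] H}
    (hA : Dense (A.domain : Set H)) {y w : H} :
    (y, w) ∈ A.adjoint.graph ↔ ∀ p ∈ A.graph, inner ℂ y p.2 = inner ℂ w p.1 := by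
  rw [LinearPMap.adjoint_graph_eq_graph_adjoint hA, Submodule.mem_adjoint_iff]
  constructor
  · intro h p hp
    have := sub_eq_zero.1 (h p.1 p.2 hp)
    rw [← inner_conj_symm y, this, inner_conj_symm]
  · intro h a b hab
    rw [sub_eq_zero, ← inner_conj_symm b, h (a, b) hab, inner_conj_symm]

theorem symmGraph_of_isSelfAdjoint [CompleteSpace H] {A : H →ₗ.[ℂ] H} (hA : IsSelfAdjoint A) :
    SymmGraph A.graph := fun p hp q hq => by
  have h : p ∈ A.adjoint.graph := by rwa [LinearPMap.isSelfAdjoint_def.1 hA]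
  exact ((mem_graph_adjoint hA.dense_domain (y := p.1) (w := p.2)).1 h q hq).symm

theorem isClosed_graph_of_isSelfAdjoint [CompleteSpace H] {A : H →ₗ.[ℂ] H}
    (hA : IsSelfAdjoint A) : IsClosed (A.graph : Set (H × H)) := hA.isClosed

/-- If `A` is self-adjoint then `A ± i` is onto. -/
theorem exists_shiftMap_eq [CompleteSpace H] {A : H →ₗ.[ℂ] H} (hA : IsSelfAdjoint A) {σ : ℝ}
    (hσ : σ ^ 2 = 1) (y : H) : ∃ p ∈ A.graph, shiftMap H σ p = y := by
  have hs := symmGraph_of_isSelfAdjoint hA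
  set K := A.graph.map (shiftMap H σ).toLinearMap with hK
  have hc : IsClosed (K : Set H) :=
    hs.isClosed_map_shiftMap (isClosed_graph_of_isSelfAdjoint hA) hσ
  have : CompleteSpace K := hc.completeSpace_coe
  have htop : K = ⊤ := by
    rw [← Submodule.orthogonal_eq_bot_iff, Submodule.eq_bot_iff]
    intro y hy
    have hmem : (y, ((σ : ℂ) * Complex.I) • y) ∈ A.graph := by
      rw [← LinearPMap.isSelfAdjoint_def.1 hA, mem_graph_adjoint hA.dense_domain]
      intro p hp
      have h := (Submodule.mem_orthogonal' K y).1 hy _ (Submodule.mem_map_of_mem hp)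
      change inner ℂ y (p.2 + ((σ : ℂ) * Complex.I) • p.1) = 0 at h
      rw [inner_add_right, inner_smul_right] at h
      rw [inner_smul_left]
      simp only [map_mul, Complex.conj_ofReal, Complex.conj_I]
      linear_combination h
    have h := hs.norm_sq_shiftMap (σ := -σ) (by rw [neg_sq, hσ]) hmem
    rw [shiftMap_apply] at h
    simp only [Complex.ofReal_neg, neg_mul, neg_smul, add_neg_cancel, norm_zero] at h
    rw [← norm_eq_zero]
    nlinarith [sq_nonneg ‖((σ : ℂ) * Complex.I) • y‖, sq_nonneg ‖y‖]
  have hy : y ∈ K := htop ▸ Submodule.mem_top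
  obtain ⟨p, hp, h⟩ := hy
  exact ⟨p, hp, h⟩

/-- The basic criterion: a symmetric operator `A` with `A + i` and `A - i` onto is self-adjoint.
Density of the domain need not be assumed. -/
theorem isSelfAdjoint_of_surjective [CompleteSpace H] {A : H →ₗ.[ℂ] H} (hs : SymmGraph A.graph)
    (hr : ∀ σ : ℝ, σ ^ 2 = 1 → ∀ y : H, ∃ p ∈ A.graph, shiftMap H σ p = y) :
    IsSelfAdjoint A := by
  have hd : Dense (A.domain : Set H) := by
    rw [Submodule.dense_iff_topologicalClosure_eq_top,
      Submodule.topologicalClosure_eq_top_iff, Submodule.eq_bot_iff]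
    intro y hy
    obtain ⟨p, hp, rfl⟩ := hr 1 (by norm_num) y
    have hp1 : p.1 ∈ A.domain := LinearPMap.mem_domain_of_mem_graph hp
    have h := (Submodule.mem_orthogonal' _ _).1 hy p.1 hp1
    rw [shiftMap_apply, inner_add_left, inner_smul_left] at h
    have h1 : (inner ℂ p.2 p.1).im = 0 := by
      have h := congrArg Complex.im (hs p hp p hp)
      rw [← inner_conj_symm p.1 p.2, Complex.conj_im] at h
      linarith
    have h2 := congrArg Complex.im h
    rw [inner_self_eq_norm_sq_to_K] at h2
    have h3 : ‖p.1‖ ^ 2 = 0 := by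
      simpa [h1, ← Complex.ofReal_pow] using h2
    have h4 : p.1 = 0 := by simpa using h3
    have h5 : p.2 = 0 := A.graph_fst_eq_zero_snd (x := p.1) hp h4
    simp [h4, h5]
  rw [LinearPMap.isSelfAdjoint_def]
  apply LinearPMap.eq_of_eq_graph
  have hle : A.graph ≤ A.adjoint.graph := fun p hp =>
    (mem_graph_adjoint hd (y := p.1) (w := p.2)).2 fun q hq => (hs p hp q hq).symm
  refine le_antisymm (fun q hq => ?_) hle
  obtain ⟨p, hp, hpq⟩ := hr 1 (by norm_num) (shiftMap H 1 q)
  have hd' : q - p ∈ A.adjoint.graph := Submodule.sub_mem _ hq (hle hp)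
  have h2 : (q - p).2 = -(Complex.I • (q - p).1) := by
    have : shiftMap H 1 (q - p) = 0 := by rw [map_sub, hpq, sub_self]
    rw [shiftMap_apply, Complex.ofReal_one, one_mul] at this
    exact eq_neg_of_add_eq_zero_left this
  have h0 : (q - p).1 = 0 := by
    obtain ⟨u, hu, hu'⟩ := hr (-1) (by norm_num) (q - p).1
    have h := (mem_graph_adjoint hd (y := (q - p).1) (w := (q - p).2)).1 hd' u hu
    have h' : inner ℂ (q - p).1 (shiftMap H (-1) u) = 0 := by
      rw [shiftMap_apply, inner_add_right, h, h2, inner_smul_right, inner_neg_left,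
        inner_smul_left]
      simp
    rwa [hu', inner_self_eq_zero] at h'
  have h3 : (q - p).2 = 0 := by rw [h2, h0]; simp
  have : q = p := sub_eq_zero.1 (Prod.ext h0 h3)
  rwa [this]

/-- Self-adjoint operators are maximal among symmetric operators. -/
theorem eq_of_le_of_isSelfAdjoint [CompleteSpace H] {A B : H →ₗ.[ℂ] H} (hA : IsSelfAdjoint A)
    (hB : IsSelfAdjoint B) (h : A ≤ B) : A = B := by
  apply LinearPMap.eq_of_eq_graph
  have hle := LinearPMap.le_graph_of_le h
  refine le_antisymm hle fun q hq => ?_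
  obtain ⟨p, hp, hpq⟩ := exists_shiftMap_eq hA (σ := 1) (by norm_num) (shiftMap H 1 q)
  rwa [← (symmGraph_of_isSelfAdjoint hB).eq_of_shiftMap_eq (by norm_num) (hle hp) hq hpq]

/-! ### Conjugation by unitaries -/

theorem mem_graph_conjBy {U : H ≃ₗᵢ[ℂ] H} {A : H →ₗ.[ℂ] H} {p : H × H} :
    p ∈ (conjBy U A).graph ↔ (U p.1, U p.2) ∈ A.graph := by
  constructor
  · intro h
    obtain ⟨x, hx1, hx2⟩ := (LinearPMap.mem_graph_iff _).1 h
    rw [LinearPMap.mem_graph_iff]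
    refine ⟨⟨U x, x.2⟩, by rw [← hx1], ?_⟩
    rw [← hx2]
    exact (U.apply_symm_apply _).symm
  · intro h
    obtain ⟨x, hx1, hx2⟩ := (LinearPMap.mem_graph_iff _).1 h
    have hp : p.1 ∈ (conjBy U A).domain := by
      change U p.1 ∈ A.domain
      rw [← show (x : H) = U p.1 from hx1]
      exact x.2
    rw [LinearPMap.mem_graph_iff]
    refine ⟨⟨p.1, hp⟩, rfl, ?_⟩
    change U.symm (A ⟨U p.1, hp⟩) = p.2
    rw [U.symm_apply_eq, ← show A x = U p.2 from hx2]
    congr 1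
    exact Subtype.ext hx1.symm

theorem isSelfAdjoint_conjBy [CompleteSpace H] (U : H ≃ₗᵢ[ℂ] H) {A : H →ₗ.[ℂ] H}
    (hA : IsSelfAdjoint A) : IsSelfAdjoint (conjBy U A) := by
  refine isSelfAdjoint_of_surjective (fun p hp q hq => ?_) fun σ hσ y => ?_
  · have := symmGraph_of_isSelfAdjoint hA _ (mem_graph_conjBy.1 hp) _ (mem_graph_conjBy.1 hq)
    simpa only [LinearIsometryEquiv.inner_map_map] using this
  · obtain ⟨p, hp, h⟩ := exists_shiftMap_eq hA hσ (U y)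
    refine ⟨(U.symm p.1, U.symm p.2), mem_graph_conjBy.2 (by simpa using hp), ?_⟩
    rw [shiftMap_apply] at h ⊢
    rw [← map_smul, ← map_add, h, U.symm_apply_apply]

theorem mem_graph_smul {c : ℂ} (hc : c ≠ 0) {A : H →ₗ.[ℂ] H} {p : H × H} :
    p ∈ (c • A).graph ↔ (p.1, c⁻¹ • p.2) ∈ A.graph := by
  rw [LinearPMap.smul_graph, Submodule.mem_map]
  constructor
  · rintro ⟨q, hq, rfl⟩
    simpa [hc] using hq
  · intro h
    exact ⟨_, h, by simp [hc]⟩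

theorem smul_conjBy {c : ℂ} (hc : c ≠ 0) (U : H ≃ₗᵢ[ℂ] H) (A : H →ₗ.[ℂ] H) :
    c • conjBy U A = conjBy U (c • A) := by
  apply LinearPMap.eq_of_eq_graph
  ext p
  rw [mem_graph_smul hc, mem_graph_conjBy, mem_graph_conjBy, mem_graph_smul hc, map_smul]

theorem conjBy_conjBy (U V : H ≃ₗᵢ[ℂ] H) (A : H →ₗ.[ℂ] H) :
    conjBy U (conjBy V A) = conjBy (U.trans V) A := by
  apply LinearPMap.eq_of_eq_graph
  ext p
  rw [mem_graph_conjBy, mem_graph_conjBy, mem_graph_conjBy]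
  rfl

/-! ### Resolvent sets -/

theorem mem_resolventSet_iff {A : H →ₗ.[ℂ] H} {z : ℂ} :
    z ∈ resolventSet A ↔ ∃ R : H →L[ℂ] H, (∀ y, (R y, y + z • R y) ∈ A.graph) ∧
      ∀ p ∈ A.graph, R (p.2 - z • p.1) = p.1 := by
  constructor
  · rintro ⟨R, h1, h2⟩
    refine ⟨R, fun y => ?_, fun p hp => ?_⟩
    · obtain ⟨h, h'⟩ := h1 y
      rw [LinearPMap.mem_graph_iff]
      exact ⟨⟨R y, h⟩, rfl, sub_eq_iff_eq_add.1 h'⟩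
    · obtain ⟨x, hx1, hx2⟩ := (LinearPMap.mem_graph_iff _).1 hp
      rw [← hx1, ← hx2]
      exact h2 x
  · rintro ⟨R, h1, h2⟩
    refine ⟨R, fun y => ?_, fun x => h2 (x, A x) (A.mem_graph x)⟩
    obtain ⟨x, hx1, hx2⟩ := (LinearPMap.mem_graph_iff _).1 (h1 y)
    have hx : R y ∈ A.domain := by
      rw [← show (x : H) = R y from hx1]
      exact x.2
    refine ⟨hx, sub_eq_iff_eq_add.2 ?_⟩
    rw [← show A x = y + z • R y from hx2]
    congr 1
    exact Subtype.ext hx1.symm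

theorem resolventSet_conjBy (U : H ≃ₗᵢ[ℂ] H) (A : H →ₗ.[ℂ] H) :
    resolventSet (conjBy U A) = resolventSet A := by
  have key : ∀ (U : H ≃ₗᵢ[ℂ] H) (A : H →ₗ.[ℂ] H),
      resolventSet A ⊆ resolventSet (conjBy U A) := by
    intro U A z hz
    obtain ⟨R, h1, h2⟩ := mem_resolventSet_iff.1 hz
    refine mem_resolventSet_iff.2 ⟨(U.symm : H →L[ℂ] H) ∘L R ∘L (U : H →L[ℂ] H),
      fun y => ?_, fun p hp => ?_⟩
    · rw [mem_graph_conjBy]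
      simpa using h1 (U y)
    · have := h2 _ (mem_graph_conjBy.1 hp)
      simp only at this
      rw [← map_smul, ← map_sub] at this
      change U.symm (R (U (p.2 - z • p.1))) = p.1
      rw [this, U.symm_apply_apply]
  refine Set.Subset.antisymm ?_ (key U A)
  have h := key U.symm (conjBy U A)
  have hA : conjBy U.symm (conjBy U A) = A := by
    apply LinearPMap.eq_of_eq_graph
    ext p
    rw [mem_graph_conjBy, mem_graph_conjBy, U.apply_symm_apply, U.apply_symm_apply]
  rwa [hA] at h

theorem opSpectrum_partOn_top (A : H →ₗ.[ℂ] H) {K : Submodule ℂ H} (hK : K = ⊤) :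
    opSpectrum (partOn A K) = opSpectrum A := by
  subst hK
  have hg : ∀ p : (⊤ : Submodule ℂ H) × (⊤ : Submodule ℂ H),
      p ∈ (partOn A ⊤).graph ↔ ((p.1 : H), (p.2 : H)) ∈ A.graph := by
    intro p
    constructor
    · intro h
      obtain ⟨x, hx1, hx2⟩ := (LinearPMap.mem_graph_iff _).1 h
      rw [LinearPMap.mem_graph_iff]
      exact ⟨⟨_, x.2.choose⟩, congrArg Subtype.val hx1, congrArg Subtype.val hx2⟩
    · intro h
      obtain ⟨x, hx1, hx2⟩ := (LinearPMap.mem_graph_iff _).1 h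
      have hp : (p.1 : H) ∈ A.domain := by
        rw [← show (x : H) = p.1 from hx1]
        exact x.2
      rw [LinearPMap.mem_graph_iff]
      refine ⟨⟨p.1, hp, trivial⟩, rfl, Subtype.ext ?_⟩
      change A ⟨p.1, _⟩ = (p.2 : H)
      rw [← show A x = p.2 from hx2]
      congr 1
      exact Subtype.ext hx1.symm
  rw [opSpectrum, opSpectrum, compl_inj_iff]
  set J : (⊤ : Submodule ℂ H) →L[ℂ] H := (⊤ : Submodule ℂ H).subtypeL
  set L : H →L[ℂ] (⊤ : Submodule ℂ H) :=
    (ContinuousLinearMap.id ℂ H).codRestrict ⊤ fun _ => trivial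
  ext z
  rw [mem_resolventSet_iff, mem_resolventSet_iff]
  constructor
  · rintro ⟨R, h1, h2⟩
    refine ⟨J ∘L R ∘L L, fun y => (hg _).1 (h1 (L y)), fun p hp => ?_⟩
    exact congrArg Subtype.val (h2 (L p.1, L p.2) ((hg _).2 hp))
  · rintro ⟨R, h1, h2⟩
    refine ⟨L ∘L R ∘L J, fun y => (hg _).2 (h1 y), fun p hp => Subtype.ext ?_⟩
    exact h2 _ ((hg _).1 hp)

end AbstractOperators

/-! ### Bounded multiplication operators on `L²(ℝ)` -/

/-- A bounded Borel function `ℝ → ℂ`. -/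
def BoundedBorel (τ : ℝ → ℂ) : Prop := Measurable τ ∧ ∃ C, ∀ x, ‖τ x‖ ≤ C

theorem BoundedBorel.memLp_mul {τ : ℝ → ℂ} (hτ : BoundedBorel τ) (f : L2R) :
    MemLp (fun x => τ x * f x) 2 volume := by
  obtain ⟨hm, C, hC⟩ := hτ
  refine (Lp.memLp f).of_le_mul (c := C)
    (hm.aestronglyMeasurable.mul (Lp.aestronglyMeasurable f)) (Filter.Eventually.of_forall ?_)
  intro x
  rw [norm_mul]
  gcongr
  exact hC x

theorem norm_toLp_mul_le {τ : ℝ → ℂ} (hτ : BoundedBorel τ) {C : ℝ}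
    (hC : ∀ x, ‖τ x‖ ≤ C) (f : L2R) : ‖(hτ.memLp_mul f).toLp _‖ ≤ C * ‖f‖ := by
  refine Lp.norm_le_mul_norm_of_ae_le_mul ?_
  filter_upwards [(hτ.memLp_mul f).coeFn_toLp] with x hx
  rw [hx, norm_mul]
  gcongr
  exact hC x

open scoped Classical in
/-- Multiplication by a bounded Borel function `τ` on `L²(ℝ)`; the zero operator if `τ` is not
a bounded Borel function. -/
noncomputable def mulCLM (τ : ℝ → ℂ) : L2R →L[ℂ] L2R :=
  if hτ : BoundedBorel τ then
    LinearMap.mkContinuousOfExistsBound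
      { toFun := fun f => (hτ.memLp_mul f).toLp _
        map_add' := fun f g => by
          rw [← MemLp.toLp_add, MemLp.toLp_eq_toLp_iff]
          filter_upwards [Lp.coeFn_add f g] with x hx
          simp only [Pi.add_apply] at hx ⊢
          rw [hx, mul_add]
        map_smul' := fun c f => by
          rw [RingHom.id_apply, ← MemLp.toLp_const_smul, MemLp.toLp_eq_toLp_iff]
          filter_upwards [Lp.coeFn_smul c f] with x hx
          simp only [Pi.smul_apply, smul_eq_mul] at hx ⊢
          rw [hx]
          ring }
      ⟨hτ.2.choose, fun f => norm_toLp_mul_le hτ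
        hτ.2.choose_spec f⟩
  else 0

theorem mulCLM_apply {τ : ℝ → ℂ} (hτ : BoundedBorel τ) (f : L2R) :
    mulCLM τ f = (hτ.memLp_mul f).toLp _ := by
  rw [mulCLM, dif_pos hτ]
  rfl

theorem mulCLM_coeFn {τ : ℝ → ℂ} (hτ : BoundedBorel τ) (f : L2R) :
    mulCLM τ f =ᵐ[volume] fun x => τ x * f x := by
  rw [mulCLM_apply hτ]
  exact (hτ.memLp_mul f).coeFn_toLp

theorem norm_mulCLM_apply_le {τ : ℝ → ℂ} (hτ : BoundedBorel τ) {C : ℝ}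
    (hC : ∀ x, ‖τ x‖ ≤ C) (f : L2R) : ‖mulCLM τ f‖ ≤ C * ‖f‖ := by
  rw [mulCLM_apply hτ]
  exact norm_toLp_mul_le hτ hC f

theorem inner_mulCLM_left {τ : ℝ → ℂ} (hτ : BoundedBorel τ)
    (hτ' : BoundedBorel (fun x => (starRingEnd ℂ) (τ x))) (f g : L2R) :
    inner ℂ (mulCLM τ f) g = inner ℂ f (mulCLM (fun x => (starRingEnd ℂ) (τ x)) g) := by
  rw [L2.inner_def, L2.inner_def]
  refine integral_congr_ae ?_
  filter_upwards [mulCLM_coeFn hτ f, mulCLM_coeFn hτ' g] with x h1 h2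
  rw [h1, h2]
  simp only [RCLike.inner_apply, map_mul]
  ring

/-! ### Unbounded multiplication operators -/

/-- The maximal multiplication operator by the real function `m` on `L²(ℝ)`, with domain
`{f | m f ∈ L²}`. -/
noncomputable def mulOp (m : ℝ → ℝ) : L2R →ₗ.[ℂ] L2R where
  domain :=
    { carrier := {f | MemLp (fun x => (m x : ℂ) * f x) 2 volume}
      zero_mem' := by
        refine (MemLp.zero (ε := ℂ)).ae_eq ?_
        filter_upwards [Lp.coeFn_zero ℂ 2 (volume : Measure ℝ)] with x hx
        change (0 : ℂ) = m x * _
        rw [hx, Pi.zero_apply, mul_zero]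
      add_mem' := fun {f g} hf hg => by
        refine (MemLp.add hf hg).ae_eq ?_
        filter_upwards [Lp.coeFn_add f g] with x hx
        simp only [Pi.add_apply] at hx ⊢
        rw [hx, mul_add]
      smul_mem' := fun c f hf => by
        refine (MemLp.const_smul hf c).ae_eq ?_
        filter_upwards [Lp.coeFn_smul c f] with x hx
        simp only [Pi.smul_apply, smul_eq_mul] at hx ⊢
        rw [hx]
        ring }
  toFun :=
    { toFun := fun f => f.2.toLp _
      map_add' := fun f g => by
        rw [← MemLp.toLp_add, MemLp.toLp_eq_toLp_iff]
        filter_upwards [Lp.coeFn_add (f : L2R) g] with x hx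
        simp only [Submodule.coe_add, Pi.add_apply] at hx ⊢
        rw [hx, mul_add]
      map_smul' := fun c f => by
        rw [RingHom.id_apply, ← MemLp.toLp_const_smul, MemLp.toLp_eq_toLp_iff]
        filter_upwards [Lp.coeFn_smul c (f : L2R)] with x hx
        simp only [Submodule.coe_smul, Pi.smul_apply, smul_eq_mul] at hx ⊢
        rw [hx]
        ring }

theorem mem_mulOp_domain {m : ℝ → ℝ} {f : L2R} :
    f ∈ (mulOp m).domain ↔ MemLp (fun x => (m x : ℂ) * f x) 2 volume := Iff.rfl

theorem mem_graph_mulOp {m : ℝ → ℝ} {p : L2R × L2R} :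
    p ∈ (mulOp m).graph ↔ (fun x => (m x : ℂ) * p.1 x) =ᵐ[volume] p.2 := by
  constructor
  · intro h
    obtain ⟨f, h1, h2⟩ := (LinearPMap.mem_graph_iff _).1 h
    rw [← h1, ← h2]
    exact (MemLp.coeFn_toLp f.2).symm
  · intro h
    have hd : p.1 ∈ (mulOp m).domain := (Lp.memLp p.2).ae_eq h.symm
    rw [LinearPMap.mem_graph_iff]
    refine ⟨⟨p.1, hd⟩, rfl, Lp.ext ?_⟩
    exact (MemLp.coeFn_toLp hd).trans h

theorem symmGraph_mulOp (m : ℝ → ℝ) : SymmGraph (mulOp m).graph := fun p hp q hq => by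
  rw [L2.inner_def, L2.inner_def]
  refine integral_congr_ae ?_
  filter_upwards [mem_graph_mulOp.1 hp, mem_graph_mulOp.1 hq] with x h1 h2
  rw [← h1, ← h2]
  simp only [RCLike.inner_apply, map_mul, Complex.conj_ofReal]
  ring

/-- For non-real `z` the inverse of `m - z` is multiplication by a bounded function. -/
theorem boundedBorel_inv_sub {m : ℝ → ℝ} (hm : Measurable m) {z : ℂ} (hz : z.im ≠ 0) :
    BoundedBorel (fun x => ((m x : ℂ) - z)⁻¹) := by
  refine ⟨by fun_prop, |z.im|⁻¹, fun x => ?_⟩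
  rw [norm_inv]
  refine inv_anti₀ (abs_pos.2 hz) ?_
  simpa using Complex.abs_im_le_norm ((m x : ℂ) - z)

theorem sub_ne_zero_of_im_ne_zero {z : ℂ} (hz : z.im ≠ 0) (t : ℝ) : (t : ℂ) - z ≠ 0 := by
  intro h
  apply hz
  simpa using congrArg Complex.im h

/-- The resolvent `(m - z)⁻¹` maps into the domain of multiplication by `m`. -/
theorem resolvent_mem_graph_mulOp {m : ℝ → ℝ} (hm : Measurable m) {z : ℂ} (hz : z.im ≠ 0)
    (y : L2R) : (mulCLM (fun x => ((m x : ℂ) - z)⁻¹) y,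
      y + z • mulCLM (fun x => ((m x : ℂ) - z)⁻¹) y) ∈ (mulOp m).graph := by
  rw [mem_graph_mulOp]
  filter_upwards [mulCLM_coeFn (boundedBorel_inv_sub hm hz) y,
    Lp.coeFn_add y (z • mulCLM (fun x => ((m x : ℂ) - z)⁻¹) y),
    Lp.coeFn_smul z (mulCLM (fun x => ((m x : ℂ) - z)⁻¹) y)] with x h1 h2 h3
  rw [h2, Pi.add_apply, h3, Pi.smul_apply, h1, smul_eq_mul]
  have := sub_ne_zero_of_im_ne_zero hz (m x)
  field_simp
  ring

theorem isSelfAdjoint_mulOp {m : ℝ → ℝ} (hm : Measurable m) : IsSelfAdjoint (mulOp m) := by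
  refine isSelfAdjoint_of_surjective (symmGraph_mulOp m) fun σ hσ y => ?_
  have hσ0 : σ ≠ 0 := by
    rintro rfl
    norm_num at hσ
  have hz : (-((σ : ℂ) * Complex.I)).im ≠ 0 := by simpa using hσ0
  refine ⟨_, resolvent_mem_graph_mulOp hm hz y, ?_⟩
  rw [shiftMap_apply]
  simp

theorem mem_resolventSet_mulOp {m : ℝ → ℝ} (hm : Measurable m) {z : ℂ} (hz : z.im ≠ 0) :
    z ∈ resolventSet (mulOp m) := by
  refine mem_resolventSet_iff.2 ⟨_, resolvent_mem_graph_mulOp hm hz, fun p hp => Lp.ext ?_⟩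
  filter_upwards [mulCLM_coeFn (boundedBorel_inv_sub hm hz) (p.2 - z • p.1),
    Lp.coeFn_sub p.2 (z • p.1), Lp.coeFn_smul z p.1, mem_graph_mulOp.1 hp] with x h1 h2 h3 h4
  rw [h1, h2, Pi.sub_apply, h3, Pi.smul_apply, ← h4, smul_eq_mul]
  have := sub_ne_zero_of_im_ne_zero hz (m x)
  field_simp

/-- The spectrum of multiplication by `a x` is the real line: indicator functions of short
intervals next to `t / a` are approximate eigenvectors for `t`. -/
theorem opSpectrum_mulOp {a : ℝ} (ha : a ≠ 0) :
    opSpectrum (mulOp fun x => a * x) = Set.range ((↑) : ℝ → ℂ) := by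
  have hm : Measurable fun x : ℝ => a * x := by fun_prop
  ext z
  rw [opSpectrum, Set.mem_compl_iff]
  constructor
  · intro h
    refine ⟨z.re, Complex.ext (by simp) ?_⟩
    by_contra h0
    exact h (mem_resolventSet_mulOp hm fun h1 => h0 (by simp [h1]))
  · rintro ⟨t, rfl⟩ h
    obtain ⟨R, -, hR⟩ := mem_resolventSet_iff.1 h
    -- the width of the interval is such that `‖R‖ |a| ε < 1`
    set ε : ℝ := (2 * |a| * (‖R‖ + 1))⁻¹ with hε
    have hapos : 0 < |a| := abs_pos.2 ha
    have hRpos : 0 < ‖R‖ + 1 := by positivity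
    have hεpos : 0 < ε := by positivity
    set S : Set ℝ := Set.Icc (t / a) (t / a + ε) with hS
    have hSm : MeasurableSet S := measurableSet_Icc
    have hSv : volume S ≠ ∞ := by simp [hS]
    set f : L2R := indicatorConstLp 2 hSm hSv 1 with hf
    have hf0 : 0 < ‖f‖ := by
      rw [hf, norm_indicatorConstLp (by norm_num) (by norm_num)]
      have : 0 < volume.real S := by
        rw [hS, Real.volume_real_Icc_of_le (by linarith)]
        linarith
      simp only [norm_one, one_mul]
      positivity
    have hb : ∀ x, ‖S.indicator (fun x => ((a * x : ℝ) : ℂ) - t) x‖ ≤ |a| * ε := by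
      intro x
      by_cases hx : x ∈ S
      · rw [Set.indicator_of_mem hx, ← Complex.ofReal_sub, Complex.norm_real, Real.norm_eq_abs,
          show a * x - t = a * (x - t / a) by field_simp, abs_mul]
        gcongr
        rw [abs_le]
        constructor <;> linarith [hx.1, hx.2]
      · rw [Set.indicator_of_notMem hx, norm_zero]
        positivity
    have hτ : BoundedBorel (S.indicator fun x => ((a * x : ℝ) : ℂ) - t) :=
      ⟨Measurable.indicator (by fun_prop) hSm, _, hb⟩
    set g := mulCLM (S.indicator fun x => ((a * x : ℝ) : ℂ) - t) f with hg
    have hfg : (f, g + (t : ℂ) • f) ∈ (mulOp fun x => a * x).graph := by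
      rw [mem_graph_mulOp]
      filter_upwards [mulCLM_coeFn hτ f, Lp.coeFn_add g ((t : ℂ) • f), Lp.coeFn_smul (t : ℂ) f,
        indicatorConstLp_coeFn (p := 2) (hs := hSm) (hμs := hSv) (c := (1 : ℂ))] with x h1 h2 h3 h4
      rw [h2, Pi.add_apply, h3, Pi.smul_apply, h1, smul_eq_mul, hf, h4]
      by_cases hx : x ∈ S <;> simp [hx]
    have h1 := hR _ hfg
    simp only [add_sub_cancel_right] at h1
    have h2 : ‖f‖ ≤ ‖R‖ * (|a| * ε * ‖f‖) := by
      calc ‖f‖ = ‖R g‖ := by rw [h1]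
        _ ≤ ‖R‖ * ‖g‖ := R.le_opNorm g
        _ ≤ _ := by
          gcongr
          exact norm_mulCLM_apply_le hτ hb f
    have h3 : ‖R‖ * (|a| * ε) < 1 := by
      rw [hε, ← mul_assoc, ← div_eq_mul_inv, div_lt_one (by positivity)]
      nlinarith [norm_nonneg R]
    nlinarith

/-! ### The spectral resolution of a multiplication operator -/

theorem ofReal_norm_sq_eq_lintegral (f : L2R) :
    ENNReal.ofReal (‖f‖ ^ 2) = ∫⁻ x, ‖f x‖ₑ ^ 2 := by
  have h := eLpNorm_nnreal_pow_eq_lintegral (f := f) (μ := volume) (p := 2) (by norm_num)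
  have h2 : eLpNorm f 2 volume = ENNReal.ofReal ‖f‖ := by
    rw [Lp.norm_def, ENNReal.ofReal_toReal (Lp.eLpNorm_ne_top f)]
  rw [ENNReal.ofReal_pow (norm_nonneg _), ← h2]
  simpa using h

theorem memLp_two_iff_lintegral {f : ℝ → ℂ} (hf : AEStronglyMeasurable f volume) :
    MemLp f 2 volume ↔ ∫⁻ x, ‖f x‖ₑ ^ 2 < ∞ := by
  have h := eLpNorm_nnreal_pow_eq_lintegral (f := f) (μ := volume) (p := 2) (by norm_num)
  have h' : eLpNorm f 2 volume ^ 2 = ∫⁻ x, ‖f x‖ₑ ^ 2 := by simpa using h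
  rw [← h', MemLp, and_iff_right hf]
  simp

theorem boundedBorel_indicator_one {S : Set ℝ} (hS : MeasurableSet S) :
    BoundedBorel (S.indicator fun _ => (1 : ℂ)) := by
  refine ⟨measurable_const.indicator hS, 1, fun x => ?_⟩
  by_cases hx : x ∈ S <;> simp [hx]

/-- Multiplication by the indicator function of a set. -/
noncomputable def cutoff (S : Set ℝ) : L2R →L[ℂ] L2R := mulCLM (S.indicator fun _ => (1 : ℂ))

theorem cutoff_coeFn {S : Set ℝ} (hS : MeasurableSet S) (f : L2R) :
    cutoff S f =ᵐ[volume] S.indicator f := by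
  filter_upwards [mulCLM_coeFn (boundedBorel_indicator_one hS) f] with x hx
  rw [cutoff, hx]
  by_cases h : x ∈ S <;> simp [h]

theorem cutoff_cutoff {S T : Set ℝ} (hS : MeasurableSet S) (hT : MeasurableSet T) (f : L2R) :
    cutoff S (cutoff T f) = cutoff (S ∩ T) f := by
  apply Lp.ext
  filter_upwards [cutoff_coeFn hS (cutoff T f), cutoff_coeFn hT f,
    cutoff_coeFn (hS.inter hT) f] with x h1 h2 h3
  rw [h1, h3]
  by_cases h : x ∈ S <;> by_cases h' : x ∈ T <;> simp [h, h', h2]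

theorem inner_cutoff_left {S : Set ℝ} (hS : MeasurableSet S) (f g : L2R) :
    inner ℂ (cutoff S f) g = inner ℂ f (cutoff S g) := by
  have hc : (fun x => (starRingEnd ℂ) (S.indicator (fun _ => (1 : ℂ)) x))
      = S.indicator fun _ => (1 : ℂ) := by
    ext x
    by_cases h : x ∈ S <;> simp [h]
  have h := inner_mulCLM_left (boundedBorel_indicator_one hS)
    (by rw [hc]; exact boundedBorel_indicator_one hS) f g
  rwa [hc] at h

theorem isStarProjection_cutoff {S : Set ℝ} (hS : MeasurableSet S) :
    IsStarProjection (cutoff S) := by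
  constructor
  · ext1 f
    change cutoff S (cutoff S f) = cutoff S f
    rw [cutoff_cutoff hS hS, Set.inter_self]
  · rw [ContinuousLinearMap.isSelfAdjoint_iff_isSymmetric]
    exact fun f g => inner_cutoff_left hS f g

/-- The measure with density `|f|²`. -/
noncomputable def densityMeasure (f : L2R) : Measure ℝ :=
  volume.withDensity fun x => ‖f x‖ₑ ^ 2

instance (f : L2R) : IsFiniteMeasure (densityMeasure f) := by
  refine isFiniteMeasure_withDensity ?_
  rw [← ofReal_norm_sq_eq_lintegral]
  exact ENNReal.ofReal_ne_top

theorem ofReal_norm_sq_cutoff {S : Set ℝ} (hS : MeasurableSet S) (f : L2R) :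
    ENNReal.ofReal (‖cutoff S f‖ ^ 2) = densityMeasure f S := by
  rw [ofReal_norm_sq_eq_lintegral, densityMeasure, withDensity_apply _ hS,
    ← lintegral_indicator hS]
  refine lintegral_congr_ae ?_
  filter_upwards [cutoff_coeFn hS f] with x hx
  rw [hx]
  by_cases h : x ∈ S <;> simp [h]

theorem norm_sq_cutoff {S : Set ℝ} (hS : MeasurableSet S) (f : L2R) :
    ‖cutoff S f‖ ^ 2 = (densityMeasure f).real S := by
  rw [measureReal_def, ← ofReal_norm_sq_cutoff hS, ENNReal.toReal_ofReal (by positivity)]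

theorem cutoff_union {S T : Set ℝ} (hS : MeasurableSet S) (hT : MeasurableSet T)
    (h : Disjoint S T) (f : L2R) : cutoff (S ∪ T) f = cutoff S f + cutoff T f := by
  apply Lp.ext
  filter_upwards [cutoff_coeFn (hS.union hT) f, cutoff_coeFn hS f, cutoff_coeFn hT f,
    Lp.coeFn_add (cutoff S f) (cutoff T f)] with x h1 h2 h3 h4
  rw [h1, h4, Pi.add_apply, h2, h3, Set.indicator_union_of_disjoint h]

theorem cutoff_empty : cutoff ∅ = 0 := by
  ext1 f
  apply Lp.ext
  filter_upwards [cutoff_coeFn MeasurableSet.empty f,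
    Lp.coeFn_zero ℂ 2 (volume : Measure ℝ)] with x h1 h2
  rw [h1, zero_apply, h2]
  simp

theorem cutoff_univ : cutoff Set.univ = 1 := by
  ext1 f
  apply Lp.ext
  filter_upwards [cutoff_coeFn MeasurableSet.univ f] with x h1
  rw [h1]
  simp

theorem cutoff_biUnion {B : ℕ → Set ℝ} (hB : ∀ n, MeasurableSet (B n))
    (hd : Pairwise (Function.onFun Disjoint B)) (s : Finset ℕ) (f : L2R) :
    cutoff (⋃ n ∈ s, B n) f = ∑ n ∈ s, cutoff (B n) f := by
  induction s using Finset.induction_on with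
  | empty => simp [cutoff_empty]
  | insert n s hn ih =>
    rw [Finset.set_biUnion_insert, Finset.sum_insert hn, ← ih]
    refine cutoff_union (hB n) (s.measurableSet_biUnion fun k _ => hB k) ?_ f
    rw [Set.disjoint_iUnion₂_right]
    intro k hk
    exact hd fun h => hn (h ▸ hk)

theorem hasSum_cutoff {B : ℕ → Set ℝ} (hB : ∀ n, MeasurableSet (B n))
    (hd : Pairwise (Function.onFun Disjoint B)) (f : L2R) :
    HasSum (fun n => cutoff (B n) f) (cutoff (⋃ n, B n) f) := by
  set ν := densityMeasure f
  have hU : MeasurableSet (⋃ n, B n) := MeasurableSet.iUnion hB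
  have hν : HasSum (fun n => ν.real (B n)) (ν.real (⋃ n, B n)) := by
    have h := measure_iUnion (μ := ν) hd hB
    have hne : ∑' n, ν (B n) ≠ ∞ := by rw [← h]; exact measure_ne_top _ _
    have h2 := (ENNReal.summable_toReal hne).hasSum
    rwa [← ENNReal.tsum_toReal_eq fun n => measure_ne_top ν (B n), ← h] at h2
  rw [HasSum, SummationFilter.unconditional_filter, tendsto_iff_norm_sub_tendsto_zero]
  have key : ∀ s : Finset ℕ, ‖∑ n ∈ s, cutoff (B n) f - cutoff (⋃ n, B n) f‖ ^ 2
      = ν.real (⋃ n, B n) - ∑ n ∈ s, ν.real (B n) := by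
    intro s
    have hs : MeasurableSet (⋃ n ∈ s, B n) := s.measurableSet_biUnion fun k _ => hB k
    have hsub : (⋃ n ∈ s, B n) ⊆ ⋃ n, B n := Set.iUnion₂_subset fun n _ => Set.subset_iUnion B n
    have h1 := cutoff_union hs (hU.diff hs) Set.disjoint_sdiff_right f
    rw [Set.union_sdiff_cancel hsub] at h1
    rw [← cutoff_biUnion hB hd, h1, sub_add_cancel_left, norm_neg, norm_sq_cutoff (hU.diff hs),
      measureReal_sdiff hsub hs, measureReal_biUnion_finset (fun i _ j _ h => hd h) fun n _ => hB n]
  have h0 : Filter.Tendsto (fun s : Finset ℕ =>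
      ‖∑ n ∈ s, cutoff (B n) f - cutoff (⋃ n, B n) f‖ ^ 2) Filter.atTop (nhds 0) := by
    simp_rw [key]
    have : Filter.Tendsto (fun s : Finset ℕ => ∑ n ∈ s, ν.real (B n)) Filter.atTop
        (nhds (ν.real (⋃ n, B n))) := hν
    simpa using this.const_sub (ν.real (⋃ n, B n))
  have h1 := (Real.continuous_sqrt.tendsto 0).comp h0
  rw [Real.sqrt_zero] at h1
  refine h1.congr fun s => ?_
  exact Real.sqrt_sq (norm_nonneg _)

/-- The spectral resolution `B ↦ U* 1_{m ∈ B} U` of the conjugate by the unitary `U` of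
multiplication by `m`. -/
noncomputable def mulPVM (U : L2R ≃ₗᵢ[ℂ] L2R) {m : ℝ → ℝ} (hm : Measurable m) :
    ProjectionValuedMeasure L2R where
  proj B := (U.symm : L2R →L[ℂ] L2R) ∘L cutoff (m ⁻¹' B) ∘L (U : L2R →L[ℂ] L2R)
  isStarProjection B hB := by
    have hP := isStarProjection_cutoff (hm hB)
    constructor
    · ext1 f
      change U.symm (cutoff (m ⁻¹' B) (U (U.symm (cutoff (m ⁻¹' B) (U f)))))
        = U.symm (cutoff (m ⁻¹' B) (U f))
      rw [U.apply_symm_apply, cutoff_cutoff (hm hB) (hm hB), Set.inter_self]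
    · rw [ContinuousLinearMap.isSelfAdjoint_iff_isSymmetric]
      intro f g
      change inner ℂ (U.symm (cutoff (m ⁻¹' B) (U f))) g
        = inner ℂ f (U.symm (cutoff (m ⁻¹' B) (U g)))
      rw [← U.inner_map_map, ← U.inner_map_map f, U.apply_symm_apply, U.apply_symm_apply,
        inner_cutoff_left (hm hB)]
  proj_empty := by
    rw [Set.preimage_empty, cutoff_empty]
    ext1 f
    simp
  proj_univ := by
    rw [Set.preimage_univ, cutoff_univ]
    ext1 f
    simp
  proj_inter B C hB hC := by
    ext1 f
    change U.symm (cutoff (m ⁻¹' (B ∩ C)) (U f))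
      = U.symm (cutoff (m ⁻¹' B) (U (U.symm (cutoff (m ⁻¹' C) (U f)))))
    rw [U.apply_symm_apply, cutoff_cutoff (hm hB) (hm hC), Set.preimage_inter]
  hasSum_proj B hB hd ψ := by
    have h := hasSum_cutoff (fun n => hm (hB n))
      (fun i j hij => (hd hij).preimage m) (U ψ)
    rw [← Set.preimage_iUnion] at h
    exact (U.symm : L2R →L[ℂ] L2R).hasSum h

theorem scalarMeasure_mulPVM (U : L2R ≃ₗᵢ[ℂ] L2R) {m : ℝ → ℝ} (hm : Measurable m) (ψ : L2R) :
    (mulPVM U hm).scalarMeasure ψ = (densityMeasure (U ψ)).map m := by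
  ext B hB
  rw [ProjectionValuedMeasure.scalarMeasure_apply _ _ hB, ProjectionValuedMeasure.inner_proj _ hB,
    Measure.map_apply hm hB, ← ofReal_norm_sq_cutoff (hm hB)]
  change ENNReal.ofReal (‖U.symm (cutoff (m ⁻¹' B) (U ψ))‖ ^ 2) = _
  rw [U.symm.norm_map]

theorem aemeasurable_enorm_sq (f : L2R) :
    AEMeasurable (fun x => ‖f x‖ₑ ^ 2) volume :=
  (Lp.aestronglyMeasurable f).enorm.pow_const 2

theorem isResolutionOf_mulPVM (U : L2R ≃ₗᵢ[ℂ] L2R) {m : ℝ → ℝ} (hm : Measurable m) :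
    (mulPVM U hm).IsResolutionOf (conjBy U (mulOp m)) := by
  refine ⟨fun ψ => ?_, fun ψ => ?_⟩
  · change U ψ ∈ (mulOp m).domain ↔ _
    have hmeas : AEStronglyMeasurable (fun x => (m x : ℂ) * U ψ x) volume :=
      (Complex.continuous_ofReal.measurable.comp hm).aestronglyMeasurable.mul
        (Lp.aestronglyMeasurable (U ψ))
    rw [mem_mulOp_domain, memLp_two_iff_lintegral hmeas, scalarMeasure_mulPVM,
      lintegral_map (by fun_prop) hm, densityMeasure,
      lintegral_withDensity_eq_lintegral_mul₀ (aemeasurable_enorm_sq _) (by fun_prop)]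
    have : ∀ x, ‖(m x : ℂ) * U ψ x‖ₑ ^ 2
        = ((fun x => ‖U ψ x‖ₑ ^ 2) * fun x => ENNReal.ofReal (m x ^ 2)) x := by
      intro x
      rw [Pi.mul_apply, enorm_mul, mul_pow, mul_comm]
      congr 1
      rw [← ofReal_norm, Complex.norm_real, ← ENNReal.ofReal_pow (norm_nonneg _),
        Real.norm_eq_abs, sq_abs]
    simp_rw [this]
  · have h : ((ψ : L2R), conjBy U (mulOp m) ψ) ∈ (conjBy U (mulOp m)).graph :=
      LinearPMap.mem_graph _ ψ
    have h1 := mem_graph_mulOp.1 (mem_graph_conjBy.1 h)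
    rw [← U.inner_map_map, L2.inner_def, scalarMeasure_mulPVM,
      integral_map hm.aemeasurable (by fun_prop), densityMeasure,
      integral_withDensity_eq_integral_toReal_smul₀ (aemeasurable_enorm_sq _)
        (Filter.Eventually.of_forall fun x => by simp), ← integral_complex_ofReal]
    refine integral_congr_ae ?_
    filter_upwards [h1] with x hx
    rw [← hx]
    simp only [RCLike.inner_apply, smul_eq_mul, ENNReal.toReal_pow, toReal_enorm]
    rw [mul_assoc, Complex.mul_conj, Complex.normSq_eq_norm_sq]
    push_cast
    ring

theorem acSubspace_mulPVM (U : L2R ≃ₗᵢ[ℂ] L2R) {a : ℝ} (ha : a ≠ 0)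
    (hm : Measurable fun x : ℝ => a * x) : (mulPVM U hm).acSubspace = ⊤ := by
  rw [Submodule.eq_top_iff']
  intro ψ
  change (mulPVM U hm).scalarMeasure ψ ≪ volume
  rw [scalarMeasure_mulPVM]
  refine ((withDensity_absolutelyContinuous _ _).map hm).trans ?_
  have h := (quasi_affine a 0 ha).absolutelyContinuous
  simpa using h

/-! ### The inversion `x ↦ 1 / x` on `L²(ℝ)` -/

theorem quasi_inv : Measure.QuasiMeasurePreserving (fun x : ℝ => x⁻¹) volume volume := by
  refine ⟨measurable_inv, Measure.AbsolutelyContinuous.mk fun B hB h0 => ?_⟩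
  rw [Measure.map_apply measurable_inv hB]
  have h1 : volume ((fun x : ℝ => x⁻¹) '' (B \ {0})) = 0 := by
    refine addHaar_image_eq_zero_of_differentiableOn_of_addHaar_eq_zero volume ?_
      (measure_mono_null Set.sdiff_subset h0)
    exact fun x hx => (differentiableAt_inv hx.2).differentiableWithinAt
  refine measure_mono_null (t := ((fun x : ℝ => x⁻¹) '' (B \ {0})) ∪ {0}) ?_
    (measure_union_null h1 Real.volume_singleton)
  intro x hx
  by_cases h : x = 0
  · exact Or.inr h
  · exact Or.inl ⟨x⁻¹, ⟨hx, inv_ne_zero h⟩, inv_inv x⟩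

theorem lintegral_inversion (f : ℝ → ℂ) :
    ∫⁻ u : ℝ, ‖(u⁻¹ : ℂ) * f u⁻¹‖ₑ ^ 2 = ∫⁻ x, ‖f x‖ₑ ^ 2 := by
  have h := lintegral_image_eq_lintegral_abs_deriv_mul (s := {0}ᶜ) (f := fun x : ℝ => x⁻¹)
    (f' := fun x => -(x ^ 2)⁻¹) (measurableSet_singleton 0).compl
    (fun x hx => (hasDerivAt_inv hx).hasDerivWithinAt) (fun x _ y _ h => inv_injective h)
    (fun x => ‖f x‖ₑ ^ 2)
  have himg : (fun x : ℝ => x⁻¹) '' {0}ᶜ = {0}ᶜ := by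
    ext x
    constructor
    · rintro ⟨y, hy, rfl⟩
      exact inv_ne_zero hy
    · intro hx
      exact ⟨x⁻¹, inv_ne_zero hx, inv_inv x⟩
  rw [himg, restrict_compl_singleton] at h
  rw [h]
  refine lintegral_congr fun u => ?_
  rw [enorm_mul, mul_pow]
  congr 1
  rw [← ofReal_norm, ← ENNReal.ofReal_pow (norm_nonneg _), ← Complex.ofReal_inv,
    Complex.norm_real, Real.norm_eq_abs, sq_abs, abs_neg, abs_of_nonneg (by positivity), inv_pow]

theorem memLp_inversion (f : L2R) : MemLp (fun u : ℝ => (u⁻¹ : ℂ) * f u⁻¹) 2 volume := by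
  rw [memLp_two_iff_lintegral, lintegral_inversion, ← ofReal_norm_sq_eq_lintegral]
  · exact ENNReal.ofReal_lt_top
  · refine AEStronglyMeasurable.mul (Measurable.aestronglyMeasurable (by fun_prop)) ?_
    exact (Lp.aestronglyMeasurable f).comp_quasiMeasurePreserving quasi_inv

/-- The isometry `(I f)(u) = u⁻¹ f(u⁻¹)` of `L²(ℝ)`. -/
noncomputable def inversionIsometry : L2R →ₗᵢ[ℂ] L2R where
  toFun f := (memLp_inversion f).toLp _
  map_add' f g := by
    rw [← MemLp.toLp_add, MemLp.toLp_eq_toLp_iff]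
    filter_upwards [quasi_inv.ae (Lp.coeFn_add f g)] with x hx
    simp only [Pi.add_apply] at hx ⊢
    rw [hx, mul_add]
  map_smul' c f := by
    rw [RingHom.id_apply, ← MemLp.toLp_const_smul, MemLp.toLp_eq_toLp_iff]
    filter_upwards [quasi_inv.ae (Lp.coeFn_smul c f)] with x hx
    simp only [Pi.smul_apply, smul_eq_mul] at hx ⊢
    rw [hx]
    ring
  norm_map' f := by
    change ‖(memLp_inversion f).toLp _‖ = ‖f‖
    have h : ENNReal.ofReal (‖(memLp_inversion f).toLp _‖ ^ 2) = ENNReal.ofReal (‖f‖ ^ 2) := by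
      rw [ofReal_norm_sq_eq_lintegral, ofReal_norm_sq_eq_lintegral, ← lintegral_inversion f]
      refine lintegral_congr_ae ?_
      filter_upwards [(memLp_inversion f).coeFn_toLp] with x hx
      rw [hx]
    rw [ENNReal.ofReal_eq_ofReal_iff (by positivity) (by positivity)] at h
    exact (sq_eq_sq₀ (norm_nonneg _) (norm_nonneg _)).1 h

theorem inversionIsometry_coeFn (f : L2R) :
    inversionIsometry f =ᵐ[volume] fun u => (u⁻¹ : ℂ) * f u⁻¹ :=
  (memLp_inversion f).coeFn_toLp

theorem ae_ne_zero : ∀ᵐ x : ℝ, x ≠ 0 := by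
  rw [ae_iff]
  simp

theorem inversionIsometry_inversionIsometry (f : L2R) :
    inversionIsometry (inversionIsometry f) = f := by
  apply Lp.ext
  filter_upwards [inversionIsometry_coeFn (inversionIsometry f),
    quasi_inv.ae (inversionIsometry_coeFn f), ae_ne_zero] with u h1 h2 h3
  have : (u : ℂ) ≠ 0 := by exact_mod_cast h3
  rw [h1, h2]
  push_cast
  rw [inv_inv, inv_inv, ← mul_assoc, inv_mul_cancel₀ this, one_mul]

/-- The unitary involution `(I f)(u) = u⁻¹ f(u⁻¹)` of `L²(ℝ)`. -/
noncomputable def inversion : L2R ≃ₗᵢ[ℂ] L2R :=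
  LinearIsometryEquiv.ofSurjective inversionIsometry
    fun f => ⟨_, inversionIsometry_inversionIsometry f⟩

theorem inversion_coeFn (f : L2R) : inversion f =ᵐ[volume] fun u => (u⁻¹ : ℂ) * f u⁻¹ :=
  inversionIsometry_coeFn f

/-! ### Weak derivatives and the Fourier transform -/

theorem inner_toLp_eq_integral (s : 𝓢(ℝ, ℂ)) (f : L2R) :
    inner ℂ (s.toLp 2) f = ∫ x, (starRingEnd ℂ) (s x) * f x := by
  rw [L2.inner_def]
  refine integral_congr_ae ?_
  filter_upwards [s.coeFn_toLp 2 volume] with x hx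
  rw [hx, RCLike.inner_apply, mul_comm]

theorem fourier_derivCLM_apply (s : 𝓢(ℝ, ℂ)) (x : ℝ) :
    FourierTransform.fourier (SchwartzMap.derivCLM ℂ ℂ s) x
      = 2 * Real.pi * Complex.I * x * FourierTransform.fourier s x := by
  rw [SchwartzMap.fourier_coe, SchwartzMap.fourier_coe]
  have hd : (SchwartzMap.derivCLM ℂ ℂ s : ℝ → ℂ) = deriv s := by
    ext x
    simp
  have h := Real.fourier_deriv (f := s) s.integrable s.differentiable
    (by rw [← hd]; exact SchwartzMap.integrable _)
  rw [hd, h]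
  rfl

/-- If `g = -i f'` in the weak sense then the Fourier transform turns `g` into the multiple of the
transform of `f` by `2πx`. -/
theorem fourier_mem_graph_mulOp {f g : L2R}
    (h : ∀ s : 𝓢(ℝ, ℂ), inner ℂ ((SchwartzMap.derivCLM ℂ ℂ s).toLp 2) f
      = -(Complex.I * inner ℂ (s.toLp 2) g)) :
    (Lp.fourierTransformₗᵢ ℝ ℂ f, Lp.fourierTransformₗᵢ ℝ ℂ g)
      ∈ (mulOp fun x => 2 * Real.pi * x).graph := by
  rw [mem_graph_mulOp]
  set F := Lp.fourierTransformₗᵢ ℝ ℂ f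
  set G := Lp.fourierTransformₗᵢ ℝ ℂ g
  have hF : LocallyIntegrable F volume := (Lp.memLp F).locallyIntegrable (by norm_num)
  have hG : LocallyIntegrable G volume := (Lp.memLp G).locallyIntegrable (by norm_num)
  have hxF : LocallyIntegrable (fun x : ℝ => ((2 * Real.pi * x : ℝ) : ℂ) * F x) volume :=
    hF.continuous_mul (by fun_prop)
  refine ae_eq_of_integral_contDiff_smul_eq hxF hG fun φ hφ hφc => ?_
  have hc : HasCompactSupport fun x => (φ x : ℂ) := hφc.comp_left Complex.ofReal_zero
  set k : 𝓢(ℝ, ℂ) := hc.toSchwartzMap (Complex.ofRealCLM.contDiff.comp hφ) with hk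
  set s : 𝓢(ℝ, ℂ) := FourierTransformInv.fourierInv k with hs
  have hks : FourierTransform.fourier s = k := FourierTransform.fourier_fourierInv_eq k
  have hkx : ∀ x, k x = φ x := fun x => rfl
  have hL : ∀ t : 𝓢(ℝ, ℂ), Lp.fourierTransformₗᵢ ℝ ℂ (t.toLp 2)
      = (FourierTransform.fourier t).toLp 2 := SchwartzMap.toLp_fourier_eq
  have h1 := h s
  rw [← (Lp.fourierTransformₗᵢ ℝ ℂ).inner_map_map, ← (Lp.fourierTransformₗᵢ ℝ ℂ).inner_map_map _ g,
    hL, hL, inner_toLp_eq_integral, inner_toLp_eq_integral] at h1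
  simp_rw [fourier_derivCLM_apply, hks, hkx] at h1
  have e1 : ∀ x : ℝ, (starRingEnd ℂ) (2 * Real.pi * Complex.I * x * φ x) * F x
      = -Complex.I * (φ x • (((2 * Real.pi * x : ℝ) : ℂ) * F x)) := by
    intro x
    simp only [map_mul, Complex.conj_ofReal, Complex.conj_I, map_ofNat, Complex.real_smul]
    push_cast
    ring
  have e2 : ∀ x : ℝ, (starRingEnd ℂ) (φ x : ℂ) * G x = φ x • G x := by
    intro x
    rw [Complex.conj_ofReal, Complex.real_smul]
  change ∫ x : ℝ, (starRingEnd ℂ) (2 * Real.pi * Complex.I * x * φ x) * F x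
    = -(Complex.I * ∫ x : ℝ, (starRingEnd ℂ) (φ x : ℂ) * G x) at h1
  simp_rw [e1, e2] at h1
  rw [integral_const_mul, neg_mul, neg_inj] at h1
  exact mul_left_cancel₀ Complex.I_ne_zero h1

/-- Integration by parts against a function with a continuous extension across a single point
where it fails to be differentiable. -/
theorem integral_conj_deriv_mul {φ φ' : ℝ → ℂ} (hφ : MemLp φ 2 volume) (hφ' : MemLp φ' 2 volume)
    (hc : ContinuousAt φ 0) (hd : ∀ x ≠ 0, HasDerivAt φ (φ' x) x) (s : 𝓢(ℝ, ℂ)) :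
    ∫ x, (starRingEnd ℂ) (SchwartzMap.derivCLM ℂ ℂ s x) * φ x
      = -∫ x, (starRingEnd ℂ) (s x) * φ' x := by
  have hi : ∀ (t : 𝓢(ℝ, ℂ)) {χ : ℝ → ℂ}, MemLp χ 2 volume →
      Integrable (fun x => (starRingEnd ℂ) (t x) * χ x) := fun t χ hχ =>
    ((t.memLp 2 volume).star).integrable_mul hχ
  have h1 := hi (SchwartzMap.derivCLM ℂ ℂ s) hφ
  have h2 := hi s hφ'
  have h3 := hi s hφ
  have hs : ∀ x, HasDerivAt (fun x => (starRingEnd ℂ) (s x))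
      ((starRingEnd ℂ) (SchwartzMap.derivCLM ℂ ℂ s x)) x := fun x => by
    rw [SchwartzMap.derivCLM_apply]
    exact (s.differentiableAt.hasDerivAt).star
  have hD : ∀ x ≠ 0, HasDerivAt (fun x => (starRingEnd ℂ) (s x) * φ x)
      ((starRingEnd ℂ) (SchwartzMap.derivCLM ℂ ℂ s x) * φ x + (starRingEnd ℂ) (s x) * φ' x) x :=
    fun x hx => (hs x).mul (hd x hx)
  have h0 : ContinuousAt (fun x => (starRingEnd ℂ) (s x) * φ x) 0 :=
    (hs 0).continuousAt.mul hc
  have h12 := h1.add h2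
  have hp := integral_Ioi_of_hasDerivAt_of_tendsto (a := 0) h0.continuousWithinAt
    (fun x hx => hD x (ne_of_gt hx)) h12.integrableOn
    (tendsto_zero_of_hasDerivAt_of_integrableOn_Ioi (a := 0)
      (fun x hx => hD x (ne_of_gt hx)) h12.integrableOn h3.integrableOn)
  -- decay at `-∞` is read off on `(-∞, -1]`, which avoids the exceptional point `0`
  have hm := integral_Iic_of_hasDerivAt_of_tendsto (a := 0) h0.continuousWithinAt
    (fun x hx => hD x (ne_of_lt hx)) h12.integrableOn
    (tendsto_zero_of_hasDerivAt_of_integrableOn_Iic (a := -1)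
      (fun x hx => hD x (by rintro rfl; norm_num at hx)) h12.integrableOn h3.integrableOn)
  have hsum := intervalIntegral.integral_Iic_add_Ioi (b := 0) h12.integrableOn h12.integrableOn
  simp only [Pi.add_apply] at hsum
  rw [hp, hm, integral_add h1 h2] at hsum
  linear_combination -hsum

/-- The unitary that turns `Π₀` into multiplication by `2πx`: inversion followed by the Fourier
transform. -/
noncomputable def diagUnitary : L2R ≃ₗᵢ[ℂ] L2R :=
  inversion.trans (Lp.fourierTransformₗᵢ ℝ ℂ)

/-- The operator that corresponds to multiplication by `2πx` under `diagUnitary`, that is, to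
`-i d/du` with maximal domain under `inversion`. -/
noncomputable def piDiag : L2R →ₗ.[ℂ] L2R := conjBy diagUnitary (mulOp fun x => 2 * Real.pi * x)

theorem isSelfAdjoint_piDiag : IsSelfAdjoint piDiag :=
  isSelfAdjoint_conjBy _ (isSelfAdjoint_mulOp (by fun_prop))

/-- Membership in the graph of `piDiag` from a classical derivative off the origin. -/
theorem mem_graph_piDiag {f g : L2R} {φ φ' : ℝ → ℂ}
    (hf : inversion f =ᵐ[volume] φ) (hg : inversion g =ᵐ[volume] fun u => -(Complex.I * φ' u))
    (hc : ContinuousAt φ 0) (hd : ∀ x ≠ 0, HasDerivAt φ (φ' x) x) : (f, g) ∈ piDiag.graph := by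
  rw [piDiag, mem_graph_conjBy]
  refine fourier_mem_graph_mulOp fun s => ?_
  have hφ : MemLp φ 2 volume := (Lp.memLp (inversion f)).ae_eq hf
  have hφ' : MemLp φ' 2 volume := by
    refine ((Lp.memLp (inversion g)).const_mul Complex.I).ae_eq ?_
    filter_upwards [hg] with x hx
    rw [hx]
    linear_combination -(φ' x) * Complex.I_mul_I
  rw [inner_toLp_eq_integral, inner_toLp_eq_integral]
  have e1 : ∫ x, (starRingEnd ℂ) (SchwartzMap.derivCLM ℂ ℂ s x) * inversion f x
      = ∫ x, (starRingEnd ℂ) (SchwartzMap.derivCLM ℂ ℂ s x) * φ x := by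
    refine integral_congr_ae ?_
    filter_upwards [hf] with x hx
    rw [hx]
  have e2 : ∫ x, (starRingEnd ℂ) (s x) * inversion g x
      = -Complex.I * ∫ x, (starRingEnd ℂ) (s x) * φ' x := by
    rw [← integral_const_mul]
    refine integral_congr_ae ?_
    filter_upwards [hg] with x hx
    rw [hx]
    ring
  change ∫ x, (starRingEnd ℂ) (SchwartzMap.derivCLM ℂ ℂ s x) * inversion f x
    = -(Complex.I * ∫ x, (starRingEnd ℂ) (s x) * inversion g x)
  rw [e1, e2, integral_conj_deriv_mul hφ hφ' hc hd]
  linear_combination (-∫ x, (starRingEnd ℂ) (s x) * φ' x) * Complex.I_mul_I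

/-! ### Step functions -/

/-- The function with value `a` on `(0, ∞)` and `b` on `(-∞, 0]`. -/
noncomputable def step (a b : ℂ) (x : ℝ) : ℂ := if 0 < x then a else b

theorem boundedBorel_step (a b : ℂ) : BoundedBorel (step a b) := by
  refine ⟨Measurable.ite measurableSet_Ioi measurable_const measurable_const, max ‖a‖ ‖b‖,
    fun x => ?_⟩
  unfold step
  split_ifs
  exacts [le_max_left _ _, le_max_right _ _]

theorem step_inv {x : ℝ} (a b : ℂ) : step a b x⁻¹ = step a b x := by
  simp only [step, inv_pos]

theorem hasDerivAt_step_mul {a b : ℂ} {φ : ℝ → ℂ} {c : ℂ} {x : ℝ} (hx : x ≠ 0)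
    (h : HasDerivAt φ c x) : HasDerivAt (fun x => step a b x * φ x) (step a b x * c) x := by
  have hev : (fun y => step a b y * φ y) =ᶠ[nhds x] fun y => step a b x * φ y := by
    rcases lt_or_gt_of_ne hx with h0 | h0
    · filter_upwards [Iio_mem_nhds h0] with y hy
      rw [step, step, if_neg (not_lt.2 (le_of_lt hy)), if_neg (not_lt.2 h0.le)]
    · filter_upwards [Ioi_mem_nhds h0] with y hy
      rw [step, step, if_pos (Set.mem_Ioi.1 hy), if_pos h0]
  exact (h.const_mul _).congr_of_eventuallyEq hev

/-- Multiplication by the step function with values `a` and `b`. -/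
noncomputable def stepCLM (a b : ℂ) : L2R →L[ℂ] L2R := mulCLM (step a b)

theorem stepCLM_coeFn (a b : ℂ) (f : L2R) :
    stepCLM a b f =ᵐ[volume] fun x => step a b x * f x := mulCLM_coeFn (boundedBorel_step a b) f

/-- Cutting a Schwartz function at the origin does not leave the domain of `piDiag`: under inversion
the origin becomes infinity, and the cut takes place where the function vanishes. -/
theorem stepCLM_schwartz_mem_graph (a b : ℂ) (ψ : 𝓢(ℝ, ℂ)) :
    (stepCLM a b (ψ.toLp 2), stepCLM a b ((piSchwartz ψ).toLp 2)) ∈ piDiag.graph := by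
  refine mem_graph_piDiag (φ := fun u => step a b u * ((u⁻¹ : ℂ) * ψ u⁻¹))
    (φ' := fun u => step a b u * (-((u : ℂ) ^ 2)⁻¹ * ψ u⁻¹
      + (u⁻¹ : ℂ) * (-((u : ℂ) ^ 2)⁻¹ * deriv ψ u⁻¹))) ?_ ?_ ?_ ?_
  · filter_upwards [inversion_coeFn (stepCLM a b (ψ.toLp 2)),
      quasi_inv.ae (stepCLM_coeFn a b (ψ.toLp 2)),
      quasi_inv.ae (ψ.coeFn_toLp 2 volume)] with u h1 h2 h3
    rw [h1, h2, h3, step_inv]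
    ring
  · filter_upwards [inversion_coeFn (stepCLM a b ((piSchwartz ψ).toLp 2)),
      quasi_inv.ae (stepCLM_coeFn a b ((piSchwartz ψ).toLp 2)),
      quasi_inv.ae ((piSchwartz ψ).coeFn_toLp 2 volume)] with u h1 h2 h3
    rw [h1, h2, h3, step_inv, piSchwartz_apply]
    push_cast
    ring
  · obtain ⟨C, hC0, hC⟩ := ψ.decay 2 0
    obtain ⟨D, hD⟩ := (boundedBorel_step a b).2
    have hD0 : 0 ≤ D := (norm_nonneg _).trans (hD 0)
    have hb : ∀ u : ℝ, ‖step a b u * ((u⁻¹ : ℂ) * ψ u⁻¹)‖ ≤ D * (|u| * C) := by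
      intro u
      rw [norm_mul]
      refine mul_le_mul (hD u) ?_ (norm_nonneg _) hD0
      rcases eq_or_ne u 0 with rfl | hu
      · simp
      have h := hC u⁻¹
      rw [norm_iteratedFDeriv_zero, Real.norm_eq_abs] at h
      have hu' : |u| ≠ 0 := abs_ne_zero.2 hu
      calc ‖(u⁻¹ : ℂ) * ψ u⁻¹‖ = |u| * (|u⁻¹| ^ 2 * ‖ψ u⁻¹‖) := by
            rw [norm_mul, norm_inv, Complex.norm_real, Real.norm_eq_abs, abs_inv]
            field_simp
        _ ≤ |u| * C := by gcongr
    rw [ContinuousAt]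
    have h0 : step a b 0 * (((0 : ℝ) : ℂ)⁻¹ * ψ (0 : ℝ)⁻¹) = 0 := by simp
    rw [h0]
    refine squeeze_zero_norm hb ?_
    have : Continuous fun u : ℝ => D * (|u| * C) := by fun_prop
    simpa using this.tendsto 0
  · intro u hu
    refine hasDerivAt_step_mul hu ?_
    have hu' : (u : ℂ) ≠ 0 := by exact_mod_cast hu
    have h1 : HasDerivAt (fun u : ℝ => (u⁻¹ : ℂ)) (-((u : ℂ) ^ 2)⁻¹) u :=
      (hasDerivAt_inv hu').comp_ofReal
    have h2 : HasDerivAt (fun u : ℝ => ψ u⁻¹) (-((u : ℂ) ^ 2)⁻¹ * deriv ψ u⁻¹) u := by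
      have := (ψ.differentiableAt (x := u⁻¹)).hasDerivAt.scomp u (hasDerivAt_inv hu)
      rw [Complex.real_smul] at this
      push_cast at this
      exact this
    exact h1.mul h2

theorem inversion_zeta (θ : ℝ) : inversion (zeta θ) =ᵐ[volume] fun u =>
    Real.exp (-|u|) * Complex.exp (Complex.I * (SignType.sign u : ℝ) * (θ / 2)) := by
  filter_upwards [inversion_coeFn (zeta θ), quasi_inv.ae (memLp_zetaFun θ).coeFn_toLp,
    ae_ne_zero] with u h1 h2 hu
  have hu' : (u : ℂ) ≠ 0 := by exact_mod_cast hu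
  rw [h1, zeta, h2, zetaFun]
  have hs : SignType.sign u⁻¹ = SignType.sign u := by
    rcases lt_or_gt_of_ne hu with h | h
    · rw [sign_neg h, sign_neg (inv_lt_zero.2 h)]
    · rw [sign_pos h, sign_pos (inv_pos.2 h)]
  rw [hs, inv_inv, abs_inv, one_div, inv_inv]
  push_cast
  field_simp

theorem zeta_coeFn_eq_step (θ : ℝ) : zeta θ =ᵐ[volume] fun x =>
    step (Complex.exp (Complex.I * (θ / 2))) (Complex.exp (-(Complex.I * (θ / 2)))) x
      * (x⁻¹ * Real.exp (-(1 / |x|)) : ℝ) := by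
  filter_upwards [(memLp_zetaFun θ).coeFn_toLp, ae_ne_zero] with x hx h0
  rw [zeta, hx, zetaFun, mul_comm]
  congr 1
  rcases lt_or_gt_of_ne h0 with h | h
  · rw [step, if_neg (not_lt.2 h.le), sign_neg h]
    simp
  · rw [step, if_pos h, sign_pos h]
    simp

theorem zeta_zero_coeFn : zeta 0 =ᵐ[volume] fun x => ((x⁻¹ * Real.exp (-(1 / |x|)) : ℝ) : ℂ) := by
  filter_upwards [zeta_coeFn_eq_step 0] with x hx
  rw [hx]
  simp [step]

theorem zeta_pi : zeta (0 + Real.pi) = stepCLM Complex.I (-Complex.I) (zeta 0) := by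
  apply Lp.ext
  filter_upwards [zeta_coeFn_eq_step (0 + Real.pi), stepCLM_coeFn Complex.I (-Complex.I) (zeta 0),
    zeta_zero_coeFn] with x h1 h2 h3
  rw [h1, h2, h3]
  have e1 : Complex.exp (Complex.I * (((0 + Real.pi : ℝ) : ℂ) / 2)) = Complex.I := by
    rw [zero_add, mul_comm, Complex.exp_pi_div_two_mul_I]
  rw [Complex.exp_neg, e1, Complex.inv_I]

theorem zeta_mem_graph : (zeta 0, zeta (0 + Real.pi)) ∈ piDiag.graph := by
  refine mem_graph_piDiag (φ := fun u => ((Real.exp (-|u|) : ℝ) : ℂ))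
    (φ' := fun u => step (-1) 1 u * ((Real.exp (-|u|) : ℝ) : ℂ)) ?_ ?_ ?_ ?_
  · filter_upwards [inversion_zeta 0] with u hu
    rw [hu]
    simp
  · rw [zeta_pi]
    filter_upwards [inversion_coeFn (stepCLM Complex.I (-Complex.I) (zeta 0)),
      quasi_inv.ae (stepCLM_coeFn Complex.I (-Complex.I) (zeta 0)), inversion_coeFn (zeta 0),
      inversion_zeta 0] with u h1 h2 h3 h4
    have h5 : (u⁻¹ : ℂ) * zeta 0 u⁻¹ = ((Real.exp (-|u|) : ℝ) : ℂ) := by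
      rw [← h3, h4]
      simp
    rw [h1, h2, step_inv, mul_left_comm, h5]
    unfold step
    split_ifs <;> ring
  · exact Continuous.continuousAt (by fun_prop)
  · intro u hu
    have key : HasDerivAt (fun u : ℝ => Real.exp (-|u|))
        ((if 0 < u then -1 else 1) * Real.exp (-|u|)) u := by
      have h := (hasDerivAt_abs hu).neg.exp
      rcases lt_or_gt_of_ne hu with h0 | h0
      · rw [if_neg (not_lt.2 h0.le)]
        simpa [sign_neg h0] using h
      · rw [if_pos h0]
        simpa [sign_pos h0] using h
    have h := key.ofReal_comp
    convert h using 1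
    unfold step
    split_ifs <;> simp

/-! ### Functions with vanishing weak derivative -/

theorem integrable_smul_of_tsupport_subset {U : Set ℝ} {f : ℝ → ℂ}
    (hf : LocallyIntegrableOn f U) {g : ℝ → ℝ} (hg : Continuous g) (hgc : HasCompactSupport g)
    (hgU : tsupport g ⊆ U) : Integrable fun x => g x • f x := by
  have h1 : IntegrableOn f (tsupport g) := hf.integrableOn_compact_subset hgU hgc
  have h2 : IntegrableOn (fun x => g x • f x) (tsupport g) :=
    h1.continuousOn_smul hg.continuousOn hgc
  refine (integrableOn_iff_integrable_of_support_subset ?_).1 h2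
  exact (Function.support_smul_subset_left g f).trans (subset_tsupport g)

/-- A test function on an interval with vanishing integral is the derivative of a test function. -/
theorem exists_primitive_test {U : Set ℝ} (hU : IsOpen U) (hUc : U.OrdConnected) {K : Set ℝ}
    (hK : IsCompact K) (hKne : K.Nonempty) (hKU : K ⊆ U) {G : ℝ → ℝ} (hG : ContDiff ℝ (⊤ : ℕ∞) G)
    (hGK : tsupport G ⊆ K) (hG0 : ∫ x, G x = 0) :
    ∃ F : ℝ → ℝ, ContDiff ℝ (⊤ : ℕ∞) F ∧ HasCompactSupport F ∧ tsupport F ⊆ U ∧ deriv F = G := by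
  obtain ⟨a, haK, ha⟩ := hK.exists_isLeast hKne
  obtain ⟨b, hbK, hb⟩ := hK.exists_isGreatest hKne
  obtain ⟨a', haa', ha'U⟩ := Filter.Eventually.exists_lt (hU.mem_nhds (hKU haK))
  have hG_zero : ∀ x, x ∉ Set.Icc a b → G x = 0 := fun x hx =>
    image_eq_zero_of_notMem_tsupport fun h => hx ⟨ha (hGK h), hb (hGK h)⟩
  set F : ℝ → ℝ := fun x => ∫ y in a'..x, G y with hF
  have hderiv : ∀ x, HasDerivAt F (G x) x := fun x =>
    intervalIntegral.integral_hasDerivAt_right (hG.continuous.intervalIntegrable _ _)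
      (hG.continuous.stronglyMeasurableAtFilter _ _) hG.continuous.continuousAt
  have hdF : deriv F = G := funext fun x => (hderiv x).deriv
  have hsub : tsupport F ⊆ Set.Icc a' b := by
    refine closure_minimal (fun x hx => ?_) isClosed_Icc
    by_contra hxI
    apply hx
    rcases lt_or_ge x a' with h | h
    · refine intervalIntegral.integral_zero_ae (Filter.Eventually.of_forall fun y hy => ?_)
      rw [Set.uIoc_of_ge h.le] at hy
      exact hG_zero y fun h' => absurd h'.1 (not_le.2 (hy.2.trans_lt haa'))
    · have hbx : b < x := by
        by_contra h'
        exact hxI ⟨h, not_lt.1 h'⟩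
      rw [hF]
      dsimp only
      rw [intervalIntegral.integral_eq_integral_of_support_subset, hG0]
      intro y hy
      by_contra h'
      refine hy (hG_zero y fun hy' => h' ⟨haa'.trans_le hy'.1, hy'.2.trans hbx.le⟩)
  refine ⟨F, ?_, HasCompactSupport.of_support_subset_isCompact isCompact_Icc
    ((subset_tsupport F).trans hsub), hsub.trans (hUc.out ha'U (hKU hbK)), hdF⟩
  rw [contDiff_infty_iff_deriv, hdF]
  exact ⟨fun x => (hderiv x).differentiableAt, hG⟩

/-- The du Bois-Reymond lemma: a locally integrable function on an interval whose weak derivative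
vanishes is constant. -/
theorem ae_eq_const_of_integral_deriv_smul_eq_zero {U : Set ℝ} (hU : IsOpen U)
    (hUc : U.OrdConnected) (hne : U.Nonempty) {f : ℝ → ℂ} (hf : LocallyIntegrableOn f U)
    (h : ∀ F : ℝ → ℝ, ContDiff ℝ (⊤ : ℕ∞) F → HasCompactSupport F → tsupport F ⊆ U →
      ∫ x, deriv F x • f x = 0) :
    ∃ c : ℂ, ∀ᵐ x, x ∈ U → f x = c := by
  obtain ⟨x₀, hx₀⟩ := hne
  obtain ⟨r, hr, hrU⟩ := Metric.isOpen_iff.1 hU x₀ hx₀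
  let φ : ContDiffBump x₀ := ⟨r / 4, r / 2, by positivity, by linarith⟩
  have hφ : ContDiff ℝ (⊤ : ℕ∞) φ := φ.contDiff
  have hφc : HasCompactSupport φ := φ.hasCompactSupport
  have hφU : tsupport φ ⊆ U := by
    rw [φ.tsupport_eq]
    exact (Metric.closedBall_subset_ball (by change r / 2 < r; linarith)).trans hrU
  have hφ0 : 0 < ∫ x, φ x := φ.integral_pos
  set c : ℂ := (∫ x, φ x)⁻¹ • ∫ x, φ x • f x with hc
  refine ⟨c, ?_⟩
  have hcl : LocallyIntegrableOn (fun _ => c) U := (locallyIntegrable_const c).locallyIntegrableOn U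
  have key := hU.ae_eq_zero_of_integral_contDiff_smul_eq_zero (hf.sub hcl) ?_
  · filter_upwards [key] with x hx hxU
    exact sub_eq_zero.1 (hx hxU)
  intro g hg hgc hgU
  set t : ℝ := (∫ x, g x) * (∫ x, φ x)⁻¹ with ht
  have hGd : ContDiff ℝ (⊤ : ℕ∞) fun x => g x - t * φ x := hg.sub (contDiff_const.mul hφ)
  have hGs : tsupport (fun x => g x - t * φ x) ⊆ tsupport g ∪ tsupport φ := by
    refine (tsupport_sub g fun x => t * φ x).trans (Set.union_subset_union_right _ ?_)
    exact closure_mono (Function.support_mul_subset_right _ _)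
  have hgi : Integrable g := hg.continuous.integrable_of_hasCompactSupport hgc
  have hφi : Integrable φ := hφ.continuous.integrable_of_hasCompactSupport hφc
  have hG0 : ∫ x, (g x - t * φ x) = 0 := by
    rw [integral_sub hgi (hφi.const_mul t), integral_const_mul, ht, mul_assoc,
      inv_mul_cancel₀ hφ0.ne', mul_one, sub_self]
  obtain ⟨F, hF1, hF2, hF3, hF4⟩ := exists_primitive_test hU hUc (hgc.isCompact.union hφc.isCompact)
    ⟨x₀, Or.inr (subset_tsupport _ (φ.pos_of_mem_ball (Metric.mem_ball_self φ.rOut_pos)).ne')⟩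
    (Set.union_subset hgU hφU) hGd hGs hG0
  have h0 := h F hF1 hF2 hF3
  have i1 := integrable_smul_of_tsupport_subset hf hg.continuous hgc hgU
  have i2 := integrable_smul_of_tsupport_subset hf hφ.continuous hφc hφU
  have e1 : ∀ x, deriv F x • f x = g x • f x - t • (φ x • f x) := fun x => by
    rw [hF4, sub_smul, mul_smul]
  simp_rw [e1] at h0
  have hs0 := integral_sub i1 (i2.smul t)
  simp only [Pi.smul_apply] at hs0
  rw [hs0, integral_smul] at h0
  simp only [Pi.sub_apply, smul_sub]
  rw [integral_sub i1 (hgi.smul_const c), integral_smul_const, hc, smul_smul, ← ht, h0]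

/-! ### Weak solutions of `Π* η = ± i η` -/

/-- The half-line `{x | σ x > 0}`. -/
def halfLine (σ : ℝ) : Set ℝ := {x | 0 < σ * x}

theorem isOpen_halfLine (σ : ℝ) : IsOpen (halfLine σ) :=
  isOpen_lt continuous_const (by fun_prop)

theorem ordConnected_halfLine (σ : ℝ) : (halfLine σ).OrdConnected := by
  refine ⟨fun x hx y hy z hz => ?_⟩
  change 0 < σ * z
  rcases le_total 0 σ with h | h
  · exact lt_of_lt_of_le hx (mul_le_mul_of_nonneg_left hz.1 h)
  · exact lt_of_lt_of_le hy (mul_le_mul_of_nonpos_left hz.2 h)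

/-- For a test function `F` off the origin, `ψ = x⁻¹ e^{σ/x} F` is a test function and
`(Π + iσ) ψ = i x e^{σ/x} F'`. -/
theorem exists_schwartz_shift (σ : ℝ) {F : ℝ → ℝ} (hF : ContDiff ℝ (⊤ : ℕ∞) F)
    (hFc : HasCompactSupport F) (hF0 : (0 : ℝ) ∉ tsupport F) :
    ∃ ψ : 𝓢(ℝ, ℂ), ∀ x : ℝ, piSchwartz ψ x + σ * Complex.I * ψ x
      = Complex.I * ((x * Real.exp (σ * x⁻¹) * deriv F x : ℝ) : ℂ) := by
  set r : ℝ → ℝ := fun x => x⁻¹ * Real.exp (σ * x⁻¹) * F x with hr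
  have hrd : ContDiff ℝ (⊤ : ℕ∞) r := by
    rw [contDiff_iff_contDiffAt]
    intro x
    by_cases hx : x ∈ tsupport F
    · have hx0 : x ≠ 0 := fun h => hF0 (h ▸ hx)
      have hi : ContDiffAt ℝ (⊤ : ℕ∞) (fun x : ℝ => x⁻¹) x := contDiffAt_inv ℝ hx0
      exact (hi.mul (contDiffAt_const.mul hi).exp).mul hF.contDiffAt
    · have hev : r =ᶠ[nhds x] fun _ => 0 := by
        filter_upwards [(isClosed_tsupport F).isOpen_compl.mem_nhds hx] with y hy
        rw [hr]
        simp only [image_eq_zero_of_notMem_tsupport hy, mul_zero]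
      exact contDiffAt_const.congr_of_eventuallyEq hev
  have hrc : HasCompactSupport r := hFc.mul_left
  have hrc' : HasCompactSupport fun x => (r x : ℂ) := hrc.comp_left Complex.ofReal_zero
  refine ⟨hrc'.toSchwartzMap (Complex.ofRealCLM.contDiff.comp hrd), fun x => ?_⟩
  rw [piSchwartz_apply]
  change Complex.I * ((x : ℂ) * (r x : ℂ) + (x : ℂ) ^ 2 * deriv (fun y => (r y : ℂ)) x)
    + σ * Complex.I * (r x : ℂ) = _
  rcases eq_or_ne x 0 with rfl | hx
  · simp [hr]
  have hd : HasDerivAt r ((-(x ^ 2)⁻¹ * Real.exp (σ * x⁻¹)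
      + x⁻¹ * (Real.exp (σ * x⁻¹) * (σ * -(x ^ 2)⁻¹))) * F x
      + x⁻¹ * Real.exp (σ * x⁻¹) * deriv F x) x := by
    have hi := hasDerivAt_inv hx
    have hF' : HasDerivAt F (deriv F x) x :=
      (hF.differentiable (by simp)).differentiableAt.hasDerivAt
    exact (hi.mul ((hi.const_mul σ).exp)).mul hF'
  rw [hd.ofReal_comp.deriv, hr]
  have hx' : (x : ℂ) ≠ 0 := by exact_mod_cast hx
  push_cast
  field_simp
  ring

/-- A weak solution `η` of `Π* η = iσ η` is a multiple of `x⁻¹ e^{-σ/x}` on either half-line. -/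
theorem exists_const_of_orthogonal (σ s : ℝ) (hs : s ≠ 0) {η : L2R}
    (h : ∀ ψ : 𝓢(ℝ, ℂ),
      inner ℂ (shiftMap L2R σ (ψ.toLp 2, (piSchwartz ψ).toLp 2)) η = 0) :
    ∃ c : ℂ, ∀ᵐ x, x ∈ halfLine s → η x = c * ((x⁻¹ * Real.exp (-(σ * x⁻¹)) : ℝ) : ℂ) := by
  have hη : LocallyIntegrable η volume := (Lp.memLp η).locallyIntegrable (by norm_num)
  have hne0 : ∀ x ∈ halfLine s, x ≠ 0 := by
    rintro x hx rfl
    simp [halfLine] at hx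
  have hloc : LocallyIntegrableOn (fun x => ((x * Real.exp (σ * x⁻¹) : ℝ) : ℂ) * η x)
      (halfLine s) := by
    refine (hη.locallyIntegrableOn _).continuousOn_mul ?_ (isOpen_halfLine s).isLocallyClosed
    refine Complex.continuous_ofReal.comp_continuousOn ?_
    refine continuousOn_id.mul (Real.continuous_exp.comp_continuousOn ?_)
    exact continuousOn_const.mul (continuousOn_inv₀.mono hne0)
  obtain ⟨c, hc⟩ := ae_eq_const_of_integral_deriv_smul_eq_zero (isOpen_halfLine s)
    (ordConnected_halfLine s) ⟨s, mul_self_pos.2 hs⟩ hloc fun F hF hFc hFs => by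
      obtain ⟨ψ, hψ⟩ := exists_schwartz_shift σ hF hFc fun h0 => hne0 0 (hFs h0) rfl
      have h1 := h ψ
      rw [shiftMap_apply, L2.inner_def] at h1
      have h2 : ∫ x, (-Complex.I) * (deriv F x • (((x * Real.exp (σ * x⁻¹) : ℝ) : ℂ) * η x)) = 0 := by
        rw [← h1]
        refine integral_congr_ae ?_
        filter_upwards [ψ.coeFn_toLp 2 volume, (piSchwartz ψ).coeFn_toLp 2 volume,
          Lp.coeFn_add ((piSchwartz ψ).toLp 2) (((σ : ℂ) * Complex.I) • ψ.toLp 2),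
          Lp.coeFn_smul ((σ : ℂ) * Complex.I) (ψ.toLp 2)] with x e1 e2 e3 e4
        rw [e3, Pi.add_apply, e4, Pi.smul_apply, e1, e2, smul_eq_mul, hψ, RCLike.inner_apply,
          map_mul, Complex.conj_I, Complex.conj_ofReal, Complex.real_smul]
        push_cast
        ring
      rw [integral_const_mul] at h2
      exact (mul_eq_zero.1 h2).resolve_left (neg_ne_zero.2 Complex.I_ne_zero)
  refine ⟨c, ?_⟩
  filter_upwards [hc] with x hx hxs
  have hx0 : (x : ℂ) ≠ 0 := by exact_mod_cast hne0 x hxs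
  rw [← hx hxs, Real.exp_neg]
  push_cast
  have := Complex.exp_ne_zero ((σ : ℂ) * (x : ℂ)⁻¹)
  field_simp

/-- The solution `x⁻¹ e^{-σ/x}` is not square integrable on the half-line where `σ/x < 0`. -/
theorem eq_zero_of_ae_eq_of_neg {σ s : ℝ} (hσs : σ * s < 0) {η : L2R} {c : ℂ}
    (h : ∀ᵐ x, x ∈ halfLine s → η x = c * ((x⁻¹ * Real.exp (-(σ * x⁻¹)) : ℝ) : ℂ)) : c = 0 := by
  by_contra hc
  have hs0 : s ≠ 0 := by
    rintro rfl
    simp at hσs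
  have hη : LocallyIntegrable η volume := (Lp.memLp η).locallyIntegrable (by norm_num)
  have hi : IntervalIntegrable η volume 0 s :=
    intervalIntegrable_iff.2 ((hη.integrableOn_isCompact isCompact_uIcc).mono_set
      Set.uIoc_subset_uIcc)
  have hinv : IntervalIntegrable (fun x : ℝ => x⁻¹) volume 0 s := by
    refine (hi.norm.const_mul ‖c‖⁻¹).mono_fun (by fun_prop) ?_
    rw [Filter.EventuallyLE, ae_restrict_iff' measurableSet_uIoc]
    filter_upwards [h, ae_ne_zero] with x hx hx0 hxs
    have hxs' : 0 < s * x := by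
      rcases lt_or_gt_of_ne hs0 with h' | h'
      · rw [Set.uIoc_of_ge h'.le] at hxs
        exact mul_pos_of_neg_of_neg h' (lt_of_le_of_ne hxs.2 hx0)
      · rw [Set.uIoc_of_le h'.le] at hxs
        exact mul_pos h' hxs.1
    have hσx : σ * x⁻¹ ≤ 0 := by
      have h1 : (σ * x⁻¹) * (s * x) = σ * s := by field_simp
      by_contra h'
      nlinarith [mul_pos (not_le.1 h') hxs']
    have hcn : ‖‖c‖⁻¹‖ = ‖c‖⁻¹ := by rw [norm_inv, norm_norm]
    rw [hx hxs', norm_mul, hcn, norm_norm, norm_mul, Complex.norm_real, norm_mul, Real.norm_eq_abs (Real.exp _), abs_of_pos (Real.exp_pos _), ← mul_assoc,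
      inv_mul_cancel₀ (norm_ne_zero_iff.2 hc), one_mul]
    exact le_mul_of_one_le_right (norm_nonneg _) (Real.one_le_exp (by linarith))
  rw [intervalIntegrable_inv_iff] at hinv
  rcases hinv with h' | h'
  · exact hs0 h'.symm
  · exact h' Set.left_mem_uIcc

/-- The deficiency spaces of `Π` are at most one-dimensional: for `σ = 1` (`σ = -1`) a weak
solution of `Π* η = iσ η` in `L²` is a multiple of the restriction of `ζ₀` to the positive
(negative) half-line. -/
theorem exists_ae_eq_of_orthogonal {σ : ℝ} (hσ : σ ^ 2 = 1) {η : L2R}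
    (h : ∀ ψ : 𝓢(ℝ, ℂ),
      inner ℂ (shiftMap L2R σ (ψ.toLp 2, (piSchwartz ψ).toLp 2)) η = 0) :
    ∃ c : ℂ, ∀ᵐ x, (0 < σ * x → η x = c * zeta 0 x) ∧ (σ * x < 0 → η x = 0) := by
  have hσ0 : σ ≠ 0 := by
    rintro rfl
    norm_num at hσ
  obtain ⟨c, hc⟩ := exists_const_of_orthogonal σ σ hσ0 h
  obtain ⟨d, hd⟩ := exists_const_of_orthogonal σ (-σ) (neg_ne_zero.2 hσ0) h
  have hd0 : d = 0 := eq_zero_of_ae_eq_of_neg (by nlinarith) hd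
  refine ⟨c, ?_⟩
  filter_upwards [hc, hd, zeta_zero_coeFn] with x h1 h2 h3
  refine ⟨fun hx => ?_, fun hx => ?_⟩
  · have habs : |x| = σ * x := by
      have hσ1 : |σ| = 1 := by rw [← Real.sqrt_sq_eq_abs, hσ, Real.sqrt_one]
      rw [← abs_of_pos hx, abs_mul, hσ1, one_mul]
    have e : σ * x⁻¹ = 1 / |x| := by
      rw [habs]
      have hx0 : x ≠ 0 := by
        rintro rfl
        simp at hx
      field_simp
      exact hσ
    rw [h1 hx, h3, e]
  · rw [h2 (by change 0 < -σ * x; linarith), hd0, zero_mul]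

/-! ### Algebra of step multipliers -/

theorem stepCLM_stepCLM (a b c d : ℂ) (f : L2R) :
    stepCLM a b (stepCLM c d f) = stepCLM (a * c) (b * d) f := by
  apply Lp.ext
  filter_upwards [stepCLM_coeFn a b (stepCLM c d f), stepCLM_coeFn c d f,
    stepCLM_coeFn (a * c) (b * d) f] with x h1 h2 h3
  rw [h1, h2, h3]
  unfold step
  split_ifs <;> ring

theorem stepCLM_add (a b c d : ℂ) (f : L2R) :
    stepCLM a b f + stepCLM c d f = stepCLM (a + c) (b + d) f := by
  apply Lp.ext
  filter_upwards [stepCLM_coeFn a b f, stepCLM_coeFn c d f, stepCLM_coeFn (a + c) (b + d) f,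
    Lp.coeFn_add (stepCLM a b f) (stepCLM c d f)] with x h1 h2 h3 h4
  rw [h4, Pi.add_apply, h1, h2, h3]
  unfold step
  split_ifs <;> ring

theorem stepCLM_self (c : ℂ) (f : L2R) : stepCLM c c f = c • f := by
  apply Lp.ext
  filter_upwards [stepCLM_coeFn c c f, Lp.coeFn_smul c f] with x h1 h2
  rw [h1, h2]
  simp [step]

theorem smul_stepCLM (a b c : ℂ) (f : L2R) :
    c • stepCLM a b f = stepCLM (c * a) (c * b) f := by
  rw [← stepCLM_self, stepCLM_stepCLM]

theorem inner_stepCLM_left (a b : ℂ) (f g : L2R) :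
    inner ℂ (stepCLM a b f) g
      = inner ℂ f (stepCLM ((starRingEnd ℂ) a) ((starRingEnd ℂ) b) g) := by
  have hc : (fun x => (starRingEnd ℂ) (step a b x))
      = step ((starRingEnd ℂ) a) ((starRingEnd ℂ) b) := by
    ext x
    unfold step
    split_ifs <;> rfl
  have h := inner_mulCLM_left (boundedBorel_step a b)
    (by rw [hc]; exact boundedBorel_step _ _) f g
  rwa [hc] at h

/-- The unitary multiplication by the step function with unimodular values `a` and `b`. -/
noncomputable def stepUnitary {a b : ℂ} (ha : ‖a‖ = 1) (hb : ‖b‖ = 1) : L2R ≃ₗᵢ[ℂ] L2R :=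
  have hinv : ∀ {a b : ℂ}, ‖a‖ = 1 → ‖b‖ = 1 → ∀ f : L2R,
      stepCLM ((starRingEnd ℂ) a) ((starRingEnd ℂ) b) (stepCLM a b f) = f := fun {a b} ha hb f => by
    rw [stepCLM_stepCLM, mul_comm, mul_comm _ b, Complex.mul_conj, Complex.mul_conj,
      Complex.normSq_eq_norm_sq, Complex.normSq_eq_norm_sq, ha, hb, one_pow, Complex.ofReal_one,
      stepCLM_self, one_smul]
  have hle : ∀ {a b : ℂ}, ‖a‖ = 1 → ‖b‖ = 1 → ∀ f : L2R, ‖stepCLM a b f‖ ≤ ‖f‖ :=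
    fun {a b} ha hb f => by
      have h := norm_mulCLM_apply_le (boundedBorel_step a b) (C := 1)
        (fun x => by unfold step; split_ifs <;> simp [ha, hb]) f
      rwa [one_mul] at h
  { toLinearEquiv := LinearEquiv.ofLinearMap (stepCLM a b).toLinearMap
      (stepCLM ((starRingEnd ℂ) a) ((starRingEnd ℂ) b)).toLinearMap
      (LinearMap.ext fun f => by
        have h := hinv (a := (starRingEnd ℂ) a) (b := (starRingEnd ℂ) b) (by simpa using ha)
          (by simpa using hb) f
        rwa [Complex.conj_conj, Complex.conj_conj] at h)
      (LinearMap.ext fun f => hinv ha hb f)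
    norm_map' := fun f => by
      refine le_antisymm (hle ha hb f) ?_
      have h := hle (a := (starRingEnd ℂ) a) (b := (starRingEnd ℂ) b) (by simpa using ha)
        (by simpa using hb) (stepCLM a b f)
      rwa [hinv ha hb f] at h }

theorem stepUnitary_apply {a b : ℂ} (ha : ‖a‖ = 1) (hb : ‖b‖ = 1) (f : L2R) :
    stepUnitary ha hb f = stepCLM a b f := rfl

/-! ### Deficiency spaces of `Π` and the realization `Π₀` -/

theorem mem_graph_piMin {p : L2R × L2R} :
    p ∈ piMin.graph ↔ ∃ ψ : 𝓢(ℝ, ℂ), p = (ψ.toLp 2, (piSchwartz ψ).toLp 2) := by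
  constructor
  · intro h
    obtain ⟨x, hx1, hx2⟩ := (LinearPMap.mem_graph_iff _).1 h
    refine ⟨schwartzEquiv.symm x, Prod.ext ?_ hx2.symm⟩
    rw [← hx1]
    exact (congrArg Subtype.val (schwartzEquiv.apply_symm_apply x)).symm
  · rintro ⟨ψ, rfl⟩
    rw [LinearPMap.mem_graph_iff]
    refine ⟨schwartzEquiv ψ, rfl, ?_⟩
    change (piSchwartz (schwartzEquiv.symm (schwartzEquiv ψ))).toLp 2 = _
    rw [LinearEquiv.symm_apply_apply]

theorem piMin_le_piDiag : piMin ≤ piDiag := by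
  refine LinearPMap.le_of_le_graph fun p hp => ?_
  obtain ⟨ψ, rfl⟩ := mem_graph_piMin.1 hp
  have h := stepCLM_schwartz_mem_graph 1 1 ψ
  rwa [stepCLM_self, stepCLM_self, one_smul, one_smul] at h

theorem isClosable_piMin : piMin.IsClosable :=
  isSelfAdjoint_piDiag.isClosed.isClosable.leIsClosable piMin_le_piDiag

theorem graph_piClosed : piClosed.graph = piMin.graph.topologicalClosure :=
  isClosable_piMin.graph_closure_eq_closure_graph.symm

theorem isClosed_graph_piClosed : IsClosed (piClosed.graph : Set (L2R × L2R)) := by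
  rw [graph_piClosed]
  exact Submodule.isClosed_topologicalClosure _

theorem graph_piClosed_le_piDiag : piClosed.graph ≤ piDiag.graph := by
  rw [graph_piClosed]
  exact Submodule.topologicalClosure_minimal _ (LinearPMap.le_graph_of_le piMin_le_piDiag)
    (isClosed_graph_of_isSelfAdjoint isSelfAdjoint_piDiag)

theorem symmGraph_piDiag : SymmGraph piDiag.graph := symmGraph_of_isSelfAdjoint isSelfAdjoint_piDiag

theorem symmGraph_piClosed : SymmGraph piClosed.graph :=
  symmGraph_piDiag.mono graph_piClosed_le_piDiag

/-- Multiplication by a step function maps the domain of the closed operator `Π` into the domain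
of `piDiag`. -/
theorem stepCLM_mem_graph_piDiag (a b : ℂ) {p : L2R × L2R} (hp : p ∈ piClosed.graph) :
    (stepCLM a b p.1, stepCLM a b p.2) ∈ piDiag.graph := by
  have hle : piClosed.graph ≤ piDiag.graph.comap
      ((stepCLM a b).toLinearMap.prodMap (stepCLM a b).toLinearMap) := by
    rw [graph_piClosed]
    refine Submodule.topologicalClosure_minimal _ (fun q hq => ?_) ?_
    · obtain ⟨ψ, rfl⟩ := mem_graph_piMin.1 hq
      exact stepCLM_schwartz_mem_graph a b ψ
    · exact (isClosed_graph_of_isSelfAdjoint isSelfAdjoint_piDiag).preimage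
        ((stepCLM a b).prodMap (stepCLM a b)).continuous
  exact hle hp

/-- For `σ = 1` and `σ = -1` the vector that spans the orthogonal complement of the range of
`Π + iσ`, namely the restriction of `ζ₀` to the half-line `σ x > 0`. -/
noncomputable def defect (σ : ℝ) : L2R := stepCLM ((1 + σ) / 2) ((1 - σ) / 2) (zeta 0)

theorem inner_defect_shiftMap {σ : ℝ} (hσ : σ ^ 2 = 1) {p : L2R × L2R} (hp : p ∈ piClosed.graph) :
    inner ℂ (defect σ) (shiftMap L2R σ p) = 0 := by
  set a : ℂ := (1 + σ) / 2 with ha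
  set b : ℂ := (1 - σ) / 2 with hb
  have ha' : (starRingEnd ℂ) a = a := by simp only [ha, map_div₀, map_add, map_one, Complex.conj_ofReal, map_ofNat]
  have hb' : (starRingEnd ℂ) b = b := by simp only [hb, map_div₀, map_sub, map_one, Complex.conj_ofReal, map_ofNat]
  have hσ' : (σ : ℂ) ^ 2 = 1 := by exact_mod_cast hσ
  have hs := symmGraph_piDiag _ zeta_mem_graph _ (stepCLM_mem_graph_piDiag a b hp)
  simp only at hs
  rw [zeta_pi, inner_stepCLM_left, stepCLM_stepCLM] at hs
  rw [defect, inner_stepCLM_left, ha', hb', shiftMap_apply, map_add, map_smul, inner_add_right,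
    ← hs, smul_stepCLM, ← inner_add_right, stepCLM_add]
  have e1 : (starRingEnd ℂ) Complex.I * a + σ * Complex.I * a = 0 := by
    rw [ha, Complex.conj_I]
    linear_combination (Complex.I / 2) * hσ'
  have e2 : (starRingEnd ℂ) (-Complex.I) * b + σ * Complex.I * b = 0 := by
    rw [hb, map_neg, Complex.conj_I]
    linear_combination (-Complex.I / 2) * hσ'
  rw [e1, e2, stepCLM_self, zero_smul, inner_zero_right]

theorem exists_eq_smul_defect {σ : ℝ} (hσ : σ ^ 2 = 1) {η : L2R}
    (h : ∀ p ∈ piClosed.graph, inner ℂ (shiftMap L2R σ p) η = 0) :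
    ∃ c : ℂ, η = c • defect σ := by
  obtain ⟨c, hc⟩ := exists_ae_eq_of_orthogonal hσ (η := η) fun ψ =>
    h _ (LinearPMap.le_graph_of_le piMin.le_closure (mem_graph_piMin.2 ⟨ψ, rfl⟩))
  refine ⟨c, ?_⟩
  rw [defect, smul_stepCLM]
  apply Lp.ext
  filter_upwards [hc, stepCLM_coeFn (c * ((1 + σ) / 2)) (c * ((1 - σ) / 2)) (zeta 0), ae_ne_zero]
    with x h1 h2 h0
  rw [h2]
  rcases sq_eq_one_iff.1 hσ with rfl | rfl <;> rcases lt_or_gt_of_ne h0 with hx | hx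
  · rw [h1.2 (by linarith), step, if_neg (not_lt.2 hx.le)]
    simp
  · rw [h1.1 (by linarith), step, if_pos hx]
    push_cast
    ring
  · rw [h1.1 (by linarith), step, if_neg (not_lt.2 hx.le)]
    push_cast
    ring
  · rw [h1.2 (by linarith), step, if_pos hx]
    simp

theorem exists_shiftMap_eq_of_inner_defect {σ : ℝ} (hσ : σ ^ 2 = 1) {y : L2R}
    (hy : inner ℂ (defect σ) y = 0) : ∃ p ∈ piClosed.graph, shiftMap L2R σ p = y := by
  set K := piClosed.graph.map (shiftMap L2R σ).toLinearMap with hK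
  have hc : IsClosed (K : Set L2R) :=
    symmGraph_piClosed.isClosed_map_shiftMap isClosed_graph_piClosed hσ
  have : CompleteSpace K := hc.completeSpace_coe
  have hyK : y ∈ K := by
    rw [← K.orthogonal_orthogonal, Submodule.mem_orthogonal]
    intro η hη
    obtain ⟨c, rfl⟩ := exists_eq_smul_defect hσ (η := η) fun p hp =>
      (Submodule.mem_orthogonal K η).1 hη _ (Submodule.mem_map_of_mem hp)
    rw [inner_smul_left, hy, mul_zero]
  obtain ⟨p, hp, h⟩ := hyK
  exact ⟨p, hp, h⟩

theorem mem_graph_piClosed {p : L2R × L2R} (hp : p ∈ piDiag.graph)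
    (h : inner ℂ (defect 1) (shiftMap L2R 1 p) = 0) : p ∈ piClosed.graph := by
  obtain ⟨q, hq, hqp⟩ := exists_shiftMap_eq_of_inner_defect (by norm_num) h
  rwa [← symmGraph_piDiag.eq_of_shiftMap_eq (by norm_num) (graph_piClosed_le_piDiag hq) hp hqp]

/-- The domain of the closed operator `Π` is invariant under multiplication by step functions. -/
theorem stepCLM_mem_graph_piClosed (a b : ℂ) {p : L2R × L2R} (hp : p ∈ piClosed.graph) :
    (stepCLM a b p.1, stepCLM a b p.2) ∈ piClosed.graph := by
  refine mem_graph_piClosed (stepCLM_mem_graph_piDiag a b hp) ?_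
  have h := inner_defect_shiftMap (σ := 1) (by norm_num) hp
  have e1 : shiftMap L2R 1 (stepCLM a b p.1, stepCLM a b p.2)
      = stepCLM a b (shiftMap L2R 1 p) := by
    rw [shiftMap_apply, shiftMap_apply, map_add, map_smul]
  have e2 : stepCLM ((starRingEnd ℂ) a) ((starRingEnd ℂ) b) (defect 1)
      = (starRingEnd ℂ) a • defect 1 := by
    rw [defect, stepCLM_stepCLM, smul_stepCLM]
    simp
  have e3 := inner_stepCLM_left ((starRingEnd ℂ) a) ((starRingEnd ℂ) b) (defect 1)
    (shiftMap L2R 1 p)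
  rw [Complex.conj_conj, Complex.conj_conj, e2, inner_smul_left, h, mul_zero] at e3
  rw [e1, ← e3]

theorem zeta_zero_eq : zeta 0 = defect 1 + defect (-1) := by
  rw [defect, defect, stepCLM_add]
  norm_num [stepCLM_self]

theorem zeta_pi_eq : zeta (0 + Real.pi) = Complex.I • defect 1 - Complex.I • defect (-1) := by
  rw [zeta_pi, defect, defect, sub_eq_add_neg, ← neg_smul, smul_stepCLM, smul_stepCLM, stepCLM_add]
  norm_num

theorem defect_ne_zero : defect 1 ≠ 0 := by
  intro h
  have h1 := stepCLM_coeFn ((1 + (1 : ℝ)) / 2) ((1 - (1 : ℝ)) / 2) (zeta 0)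
  rw [← defect, h] at h1
  have h2 : ∀ᵐ x : ℝ, x ∉ Set.Ioi (0 : ℝ) := by
    filter_upwards [h1, Lp.coeFn_zero ℂ 2 (volume : Measure ℝ), zeta_zero_coeFn] with x e1 e2 e3 hx
    rw [e2, e3, step, if_pos (Set.mem_Ioi.1 hx)] at e1
    have hx0 : (x : ℂ) ≠ 0 := by exact_mod_cast (ne_of_gt (Set.mem_Ioi.1 hx))
    norm_num [hx0, Complex.exp_ne_zero] at e1
  have h3 : volume (Set.Ioi (0 : ℝ)) = 0 := by
    have h4 := ae_iff.1 h2
    simpa only [not_not, Set.ofPred_mem_eq] using h4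
  simp at h3

/-- The two deficiency vectors have the same norm; this expresses the symmetry of `Π₀` at `ζ₀`. -/
theorem norm_defect : ‖defect (-1)‖ = ‖defect 1‖ := by
  have horth : inner ℂ (defect 1) (defect (-1)) = 0 := by
    rw [defect, defect, inner_stepCLM_left, stepCLM_stepCLM]
    norm_num [stepCLM_self]
  have horth' : inner ℂ (defect (-1)) (defect 1) = 0 := by
    rw [← inner_conj_symm, horth, map_zero]
  have h := symmGraph_piDiag _ zeta_mem_graph _ zeta_mem_graph
  simp only [zeta_pi_eq, zeta_zero_eq, inner_add_left, inner_add_right, inner_sub_left,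
    inner_sub_right, inner_smul_left, inner_smul_right, horth, horth', inner_self_eq_norm_sq_to_K,
    Complex.conj_I] at h
  have h2 : ((‖defect (-1)‖ : ℂ)) ^ 2 = ((‖defect 1‖ : ℂ)) ^ 2 := by
    apply mul_left_cancel₀ (mul_ne_zero two_ne_zero Complex.I_ne_zero)
    simp only [Complex.coe_algebraMap] at h
    linear_combination h
  have h3 : ‖defect (-1)‖ ^ 2 = ‖defect 1‖ ^ 2 := by exact_mod_cast h2
  exact (sq_eq_sq₀ (norm_nonneg _) (norm_nonneg _)).1 h3

theorem shiftMap_zeta :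
    shiftMap L2R 1 (zeta 0, zeta (0 + Real.pi)) = (2 * Complex.I) • defect 1 := by
  rw [shiftMap_apply]
  simp only [zeta_pi_eq, zeta_zero_eq, Complex.ofReal_one, one_mul]
  module

theorem graph_sup_span_eq :
    piClosed.graph ⊔ Submodule.span ℂ {(zeta 0, zeta (0 + Real.pi))} = piDiag.graph := by
  refine le_antisymm (sup_le graph_piClosed_le_piDiag ?_) fun p hp => ?_
  · rw [Submodule.span_singleton_le_iff_mem]
    exact zeta_mem_graph
  · have hne : inner ℂ (defect 1) (defect 1) ≠ 0 := inner_self_ne_zero.2 defect_ne_zero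
    -- the multiple of `ζ₀` whose subtraction makes the shifted vector orthogonal to the defect
    set c : ℂ := (2 * Complex.I)⁻¹ * (inner ℂ (defect 1) (shiftMap L2R 1 p)
      / inner ℂ (defect 1) (defect 1)) with hc
    set q : L2R × L2R := (zeta 0, zeta (0 + Real.pi)) with hq
    have hpq : p - c • q ∈ piClosed.graph := by
      refine mem_graph_piClosed
        (Submodule.sub_mem _ hp (Submodule.smul_mem _ c zeta_mem_graph)) ?_
      rw [map_sub, map_smul, hq, shiftMap_zeta, inner_sub_right, inner_smul_right, inner_smul_right,
        hc]
      have := Complex.I_ne_zero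
      field_simp
      ring
    rw [← sub_add_cancel p (c • q)]
    exact Submodule.add_mem_sup hpq
      (Submodule.smul_mem _ c (Submodule.mem_span_singleton_self q))

theorem piTheta_zero : piTheta 0 = piDiag := by
  apply LinearPMap.eq_of_eq_graph
  rw [piTheta, graph_sup_span_eq]
  exact Submodule.toLinearPMap_graph_eq _ fun x hx h0 => piDiag.graph_fst_eq_zero_snd hx h0

/-! ### Self-adjoint extensions of `Π` -/

/-- Every self-adjoint extension of `Π` is conjugate to `piDiag` by multiplication by a unimodular
step function, whose value on the negative half-line is read off from the Cayley transform. -/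
theorem exists_conjBy_eq_piDiag {P : L2R →ₗ.[ℂ] L2R} (hP : IsSelfAdjoint P) (hle : piClosed ≤ P) :
    ∃ V : L2R ≃ₗᵢ[ℂ] L2R, conjBy V P = piDiag := by
  have hg := LinearPMap.le_graph_of_le hle
  have hs := symmGraph_of_isSelfAdjoint hP
  obtain ⟨q, hq, hq1⟩ := exists_shiftMap_eq hP (σ := 1) (by norm_num) (defect 1)
  -- the Cayley transform of `P` maps `defect 1` to `w`, a multiple of `defect (-1)`
  set w := shiftMap L2R (-1) q with hw
  obtain ⟨c, hc⟩ := exists_eq_smul_defect (σ := -1) (by norm_num) (η := w) fun p hp => by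
    have h1 := inner_defect_shiftMap (σ := 1) (by norm_num) hp
    have h2 := hs q hq p (hg hp)
    rw [← inner_conj_symm, hw]
    rw [← hq1] at h1
    simp only [shiftMap_apply, inner_add_left, inner_add_right, inner_smul_left, inner_smul_right,
      map_mul, Complex.conj_ofReal, Complex.conj_I] at h1 ⊢
    push_cast at h1 ⊢
    rw [map_eq_zero]
    linear_combination h1 - 2 * Complex.I * h2
  have hnorm : ‖w‖ = ‖defect 1‖ := by
    have h1 := hs.norm_sq_shiftMap (σ := 1) (by norm_num) hq
    have h2 := hs.norm_sq_shiftMap (σ := -1) (by norm_num) hq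
    rw [hq1] at h1
    exact (sq_eq_sq₀ (norm_nonneg _) (norm_nonneg _)).1 (h2.trans h1.symm)
  have hc1 : ‖-c‖ = 1 := by
    rw [hc, norm_smul, norm_defect] at hnorm
    rw [norm_neg]
    exact mul_right_cancel₀ (norm_ne_zero_iff.2 defect_ne_zero) (hnorm.trans (one_mul _).symm)
  refine ⟨stepUnitary (a := 1) norm_one hc1, ?_⟩
  refine (eq_of_le_of_isSelfAdjoint isSelfAdjoint_piDiag (isSelfAdjoint_conjBy _ hP) ?_).symm
  refine LinearPMap.le_of_le_graph ?_
  rw [← graph_sup_span_eq]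
  refine sup_le (fun p hp => ?_) ?_
  · rw [mem_graph_conjBy]
    exact hg (stepCLM_mem_graph_piClosed 1 (-c) hp)
  · rw [Submodule.span_singleton_le_iff_mem, mem_graph_conjBy, stepUnitary_apply,
      stepUnitary_apply]
    have hstep : ∀ σ : ℝ, σ ^ 2 = 1 → stepCLM 1 (-c) (defect σ)
        = ((1 + σ) / 2 - c * ((1 - σ) / 2) : ℂ) • defect σ := by
      intro σ hσ
      rw [defect, stepCLM_stepCLM, smul_stepCLM]
      rcases sq_eq_one_iff.1 hσ with rfl | rfl <;> norm_num
    have h1 := hstep 1 (by norm_num)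
    have h2 := hstep (-1) (by norm_num)
    norm_num at h1 h2
    have e1 : q.2 = (2 : ℂ)⁻¹ • (defect 1 + w) := by
      rw [← hq1, hw, shiftMap_apply, shiftMap_apply]
      push_cast
      module
    have e2 : (2 * Complex.I) • q.1 = defect 1 - w := by
      rw [← hq1, hw, shiftMap_apply, shiftMap_apply]
      push_cast
      module
    have e : (stepCLM 1 (-c) (zeta 0), stepCLM 1 (-c) (zeta (0 + Real.pi)))
        = (2 * Complex.I) • q := by
      refine Prod.ext ?_ ?_
      · change stepCLM 1 (-c) (zeta 0) = (2 * Complex.I) • q.1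
        rw [zeta_zero_eq, map_add, h1, h2, e2, hc]
        module
      · change stepCLM 1 (-c) (zeta (0 + Real.pi)) = (2 * Complex.I) • q.2
        rw [zeta_pi_eq, map_sub, map_smul, map_smul, h1, h2, e1, hc]
        module
    change (stepCLM 1 (-c) (zeta 0), stepCLM 1 (-c) (zeta (0 + Real.pi))) ∈ P.graph
    rw [e]
    exact P.graph.smul_mem _ hq

/-! ### The thermal Hamiltonian -/

theorem smul_mulOp {c : ℝ} (hc : c ≠ 0) (m : ℝ → ℝ) :
    (c : ℂ) • mulOp m = mulOp fun x => c * m x := by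
  have hc' : (c : ℂ) ≠ 0 := by exact_mod_cast hc
  apply LinearPMap.eq_of_eq_graph
  ext p
  rw [mem_graph_smul hc', mem_graph_mulOp, mem_graph_mulOp]
  constructor <;> intro h <;>
    filter_upwards [h, Lp.coeFn_smul (c : ℂ)⁻¹ p.2] with x h1 h2
  · rw [h2, Pi.smul_apply, smul_eq_mul] at h1
    push_cast
    rw [mul_assoc, h1, mul_inv_cancel_left₀ hc']
  · rw [h2, Pi.smul_apply, smul_eq_mul, ← h1]
    push_cast
    rw [mul_assoc, inv_mul_cancel_left₀ hc']

theorem thermalHamiltonian_eq_conjBy {lam : ℝ} (hlam : lam ≠ 0) :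
    thermalHamiltonian lam = conjBy ((fourierTranslation lam).trans diagUnitary)
      (mulOp fun x => (lam * (2 * Real.pi)) * x) := by
  have hlam' : (lam : ℂ) ≠ 0 := by exact_mod_cast hlam
  rw [thermalHamiltonian, piTheta_zero, piDiag, conjBy_conjBy, smul_conjBy hlam', smul_mulOp hlam]
  simp_rw [mul_assoc]

theorem isThermalHamiltonian_thermalHamiltonian (lam : ℝ) :
    IsThermalHamiltonian lam (thermalHamiltonian lam) := by
  refine ⟨piTheta 0, ?_, ?_, rfl⟩
  · rw [piTheta_zero]
    exact isSelfAdjoint_piDiag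
  · rw [piTheta_zero]
    exact LinearPMap.le_of_le_graph graph_piClosed_le_piDiag

theorem unitarilyEquivalent_thermalHamiltonian {lam : ℝ} (hlam : lam ≠ 0) {A : L2R →ₗ.[ℂ] L2R}
    (hA : IsThermalHamiltonian lam A) : UnitarilyEquivalent A (thermalHamiltonian lam) := by
  have hlam' : (lam : ℂ) ≠ 0 := by exact_mod_cast hlam
  obtain ⟨P, hP, hle, rfl⟩ := hA
  obtain ⟨V, hV⟩ := exists_conjBy_eq_piDiag hP hle
  set W := fourierTranslation lam
  refine ⟨W.trans (V.symm.trans W.symm), ?_⟩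
  rw [thermalHamiltonian, piTheta_zero, ← hV, smul_conjBy hlam', smul_conjBy hlam',
    smul_conjBy hlam', conjBy_conjBy, conjBy_conjBy]
  congr 1
  ext1 f
  change W f = V (W (W.symm (V.symm (W f))))
  rw [W.apply_symm_apply, V.apply_symm_apply]

theorem thermalHamiltonian_domain (lam : ℝ) : (thermalHamiltonian lam).domain =
    (piTheta 0).domain.map ((fourierTranslation lam).symm.toLinearEquiv : L2R →ₗ[ℂ] L2R) := by
  ext ψ
  rw [Submodule.mem_map]
  constructor
  · intro h
    exact ⟨fourierTranslation lam ψ, h, (fourierTranslation lam).symm_apply_apply ψ⟩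
  · rintro ⟨φ, hφ, rfl⟩
    change fourierTranslation lam ((fourierTranslation lam).symm φ) ∈ (piTheta 0).domain
    rwa [LinearIsometryEquiv.apply_symm_apply]

end Thermal

open Thermal
theorem theorem1p3 (lam : ℝ) (hlam : 0 < lam) :
    IsThermalHamiltonian lam (thermalHamiltonian lam) ∧
    (∀ A : L2R →ₗ.[ℂ] L2R, IsThermalHamiltonian lam A →
      UnitarilyEquivalent A (thermalHamiltonian lam)) ∧
    IsSelfAdjoint (thermalHamiltonian lam) ∧
    (thermalHamiltonian lam).domain =
      (piTheta 0).domain.map ((fourierTranslation lam).symm.toLinearEquiv : L2R →ₗ[ℂ] L2R) ∧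
    opSpectrum (thermalHamiltonian lam) = Set.range ((↑) : ℝ → ℂ) ∧
    ∃ E : ProjectionValuedMeasure L2R, E.IsResolutionOf (thermalHamiltonian lam) ∧
      E.acSubspace = ⊤ ∧
      E.acSpectrum (thermalHamiltonian lam) = Set.range ((↑) : ℝ → ℂ) := by
  have hm : Measurable fun x : ℝ => (lam * (2 * Real.pi)) * x := by fun_prop
  have h0 : lam * (2 * Real.pi) ≠ 0 := by positivity
  have heq := thermalHamiltonian_eq_conjBy hlam.ne'
  have hspec : opSpectrum (thermalHamiltonian lam) = Set.range ((↑) : ℝ → ℂ) := by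
    rw [heq, opSpectrum, resolventSet_conjBy]
    exact opSpectrum_mulOp h0
  have hac := acSubspace_mulPVM ((fourierTranslation lam).trans diagUnitary) h0 hm
  refine ⟨isThermalHamiltonian_thermalHamiltonian lam,
    fun A hA => unitarilyEquivalent_thermalHamiltonian hlam.ne' hA, ?_,
    thermalHamiltonian_domain lam, hspec,
    mulPVM ((fourierTranslation lam).trans diagUnitary) hm, ?_, hac, ?_⟩
  · rw [heq]
    exact isSelfAdjoint_conjBy _ (isSelfAdjoint_mulOp hm)
  · rw [heq]
    exact isResolutionOf_mulPVM _ hm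
  · rw [ProjectionValuedMeasure.acSpectrum, opSpectrum_partOn_top _ hac, hspec]
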